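/- Let $Q$ be a smooth $n$-manifold (Hausdorff, second countable, without boundary) with a smooth Riemannian metric $g$, let $U\in C^\infty(Q)$, and let $W\subset TQ$ be a smooth distribution of rank $k$. Let $\mathfrak p:TQ\to TQ$ be the $g$-orthogonal projector onto $W$, $\bar{\mathfrak p}=\mathrm{id}-\mathfrak p$, and let $\mathfrak p^\dagger,\bar{\mathfrak p}^\dagger$ be the transposed maps on covectors. Let $g^*$ be the metric induced by $g$ on covectors, and $H(q,p)=\tfrac12 g_q^*(p,p)+U(q)$ on $T^*Q$. The physical leaf is $\mathfrak M_{phys}=\{(q,p)\in T^*Q:\bar{\mathfrak p}(q)\,\partial_pH(q,p)=0\}$. A physical orbit on an interval $J=[0,T)$, $0<T\le\infty$, is a smooth path $\gamma=(q,p):J\to\mathfrak M_{phys}$ that satisfies, in local bundle charts $(q^i,p_i)$ of $T^*Q$, the differential-algebraic relations $$\dot q=\mathfrak p(q)\,\partial_pH(q,p),\qquad \mathfrak p^\dagger(q)\,\dot p=-\mathfrak p^\dagger(q)\,\partial_qH(q,p),\qquad \bar{\mathfrak p}(q)\,\partial_pH(q,p)=0.$$ Theorem (existence and uniqueness of physical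 orbits). 1. $\mathfrak M_{phys}=\{(q,p):\bar{\mathfrak p}^\dagger(q)p=0\}$. 2. The relations define a unique vector field tangent to $\mathfrak M_{phys}$: at every $x\in\mathfrak M_{phys}$ there is exactly one vector $X(x)\in T_x\mathfrak M_{phys}$ whose coordinates $(\dot q,\dot p)$ satisfy them, and $X$ is smooth. 3. For every $x\in\mathfrak M_{phys}$ there is a unique maximal physical orbit $\gamma:[0,T)\to\mathfrak M_{phys}$, $0<T\le\infty$, with $\gamma(0)=x$: every physical orbit $\gamma':[0,T')\to\mathfrak M_{phys}$ with $\gamma'(0)=x$ satisfies $T'\le T$ and $\gamma'=\gamma|_{[0,T')}$. If $T<\infty$, then for every compact $K\subset T^*Q$ one has $\gamma(t)\notin K$ for all $t<T$ close enough to $T$. 4. If $(Q,g)$ is complete (as a metric space with the Riemannian distance) and $U$ is bounded below, then for every $x\in\mathfrak M_{phys}$ there exists a unique physical orbit $\gamma:[0,\infty)\to\mathfrak M_{phys}$ with $\gamma(0)=x$. -/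

import Mathlib

open Set Filter Bundle
open scoped Manifold ContDiff Topology

namespace ConstrainedMechanics

noncomputable section

/-- The model space `ℝⁿ` of an `n`-dimensional manifold. -/
abbrev Model (n : ℕ) : Type := EuclideanSpace ℝ (Fin n)

/-- The dual space of `ℝⁿ`, in which the fibre coordinates of covectors take their values. -/
abbrev DualModel (n : ℕ) : Type := Model n →L[ℝ] ℝ

section Manifold

variable {n k : ℕ} {Q : Type*} [TopologicalSpace Q] [ChartedSpace (Model n) Q]

/-! ### The cotangent bundle -/

variable (n) in
/-- The cotangent space of `Q` at `q`. -/
abbrev CotangentSpace (q : Q) : Type := TangentSpace (𝓡 n) q →L[ℝ] Trivial Q ℝ q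

variable (n) in
/-- The model with corners of the cotangent bundle: it is modelled on `ℝⁿ × (ℝⁿ)*`. -/
abbrev cotangentModel :
    ModelWithCorners ℝ (Model n × DualModel n) (ModelProd (Model n) (DualModel n)) :=
  (𝓡 n).prod 𝓘(ℝ, DualModel n)

variable [IsManifold (𝓡 n) ∞ Q]

variable (n Q) in
/-- The cotangent bundle of a smooth `n`-manifold `Q`; its points are pairs `⟨q, p⟩`. -/
abbrev CotangentBundle : Type _ :=
  TotalSpace (DualModel n) (CotangentSpace n : Q → Type)

/-! ### Riemannian metric, induced metric on covectors, completeness -/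

variable (n Q) in
/-- Smooth Riemannian metrics on `Q`. -/
abbrev SmoothMetric : Type _ :=
  ContMDiffRiemannianMetric (𝓡 n) ∞ (Model n) (fun q : Q => TangentSpace (𝓡 n) q)

/-- The metric `g` at `q`, as a bilinear form on the tangent space. -/
def metricForm (g : SmoothMetric n Q) (q : Q) :
    LinearMap.BilinForm ℝ (TangentSpace (𝓡 n) q) :=
  LinearMap.mk₂ ℝ (fun v w => g.inner q v w) (by simp) (by simp) (by simp) (by simp)

/-- The inverse of the isomorphism `v ↦ g(v, ·)` from tangent vectors to covectors. -/
def sharp (g : SmoothMetric n Q) (q : Q) : CotangentSpace n q →L[ℝ] TangentSpace (𝓡 n) q :=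
  (g.inner q).inverse

/-- The tangent vector `sharp g q α` is the one that represents `α`. -/
theorem inner_sharp (g : SmoothMetric n Q) (q : Q) (α : CotangentSpace n q) :
    g.inner q (sharp g q α) = α := by
  have : FiniteDimensional ℝ (TangentSpace (𝓡 n) q) :=
    inferInstanceAs (FiniteDimensional ℝ (Model n))
  have : T2Space (TangentSpace (𝓡 n) q) := inferInstanceAs (T2Space (Model n))
  have hinj : Function.Injective (g.inner q : TangentSpace (𝓡 n) q →ₗ[ℝ] CotangentSpace n q) := by
    rw [← LinearMap.ker_eq_bot, LinearMap.ker_eq_bot']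
    intro v hv
    by_contra hne
    have hv' : g.inner q v = 0 := hv
    have hpos := g.pos q v hne
    rw [hv'] at hpos
    exact lt_irrefl _ hpos
  have hfin : Module.finrank ℝ (TangentSpace (𝓡 n) q) = Module.finrank ℝ (CotangentSpace n q) :=
    ((LinearMap.toContinuousLinearMap (𝕜 := ℝ) (E := TangentSpace (𝓡 n) q)
      (F' := ℝ)).finrank_eq.symm.trans Subspace.dual_finrank_eq).symm
  have : FiniteDimensional ℝ (CotangentSpace n q) :=
    inferInstanceAs (FiniteDimensional ℝ (Model n →L[ℝ] ℝ))
  let e : TangentSpace (𝓡 n) q ≃L[ℝ] CotangentSpace n q :=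
    (LinearEquiv.ofInjectiveOfFinrankEq _ hinj hfin).toContinuousLinearEquiv
  have he : (e : TangentSpace (𝓡 n) q →L[ℝ] CotangentSpace n q) = g.inner q := by
    ext v; rfl
  have hs : sharp g q = e.symm := by
    rw [sharp, ← he, ContinuousLinearMap.inverse_equiv]
  rw [hs, ← he]
  exact e.apply_symm_apply α

/-- The induced metric `g*` on covectors: `g*(g(v, ·), g(w, ·)) = g(v, w)`. -/
def cometric (g : SmoothMetric n Q) (q : Q) (α β : CotangentSpace n q) : ℝ :=
  g.inner q (sharp g q α) (sharp g q β)

/-- The Riemannian manifold `(Q, g)` is complete: every sequence that is Cauchy for the Riemannian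
distance (the infimum of the `g`-lengths of connecting paths) converges. -/
def IsCompleteMetric (g : SmoothMetric n Q) : Prop :=
  letI : RiemannianBundle (fun q : Q => TangentSpace (𝓡 n) q) := ⟨g.toRiemannianMetric⟩
  ∀ u : ℕ → Q,
    (∀ ε : ENNReal, 0 < ε → ∃ N : ℕ, ∀ i ≥ N, ∀ j ≥ N,
      Manifold.riemannianEDist (𝓡 n) (u i) (u j) < ε) →
    ∃ q : Q, Tendsto u atTop (𝓝 q)

/-! ### Distributions and orthogonal projectors -/

variable (n k Q) in
/-- A smooth distribution of rank `k` on `Q`: a `k`-dimensional subspace of every tangent space,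
locally spanned by `k` smooth vector fields that are pointwise linearly independent. -/
structure SmoothDistribution where
  /-- the fibre over `q` -/
  fiber : (q : Q) → Submodule ℝ (TangentSpace (𝓡 n) q)
  /-- local smooth frames exist -/
  exists_frame : ∀ q₀ : Q, ∃ V ∈ 𝓝 q₀, ∃ Y : Fin k → (q : Q) → TangentSpace (𝓡 n) q,
    (∀ i, ContMDiffOn (𝓡 n) (𝓡 n).tangent ∞
      (fun q => (⟨q, Y i q⟩ : TangentBundle (𝓡 n) Q)) V) ∧
    ∀ q ∈ V, LinearIndependent ℝ (fun i => Y i q) ∧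
      Submodule.span ℝ (range fun i => Y i q) = fiber q

/-- The `g`-orthogonal complement of the distribution `W` at `q`. -/
def orthFiber (g : SmoothMetric n Q) (W : SmoothDistribution n k Q) (q : Q) :
    Submodule ℝ (TangentSpace (𝓡 n) q) :=
  (metricForm g q).orthogonal (W.fiber q)

/-- Every tangent space is the direct sum of `W` and its `g`-orthogonal complement. -/
theorem isCompl_fiber_orthFiber (g : SmoothMetric n Q) (W : SmoothDistribution n k Q) (q : Q) :
    IsCompl (W.fiber q) (orthFiber g W q) := by
  have : FiniteDimensional ℝ (TangentSpace (𝓡 n) q) :=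
    inferInstanceAs (FiniteDimensional ℝ (Model n))
  refine LinearMap.BilinForm.isCompl_orthogonal_of_restrict_nondegenerate ?_ ?_
  · intro v w h
    exact (g.symm q w v).trans h
  · have key : ∀ v : W.fiber q, ((metricForm g q).restrict (W.fiber q)) v v = 0 → v = 0 := by
      intro v hv
      by_contra hne
      exact (g.pos q v (fun h => hne (Subtype.ext h))).ne' hv
    exact ⟨fun v hv => key v (hv v), fun v hv => key v (hv v)⟩

/-- The `g`-orthogonal projector onto `W`: the identity on `W`, with kernel the orthogonal
complement of `W`. -/
def proj (g : SmoothMetric n Q) (W : SmoothDistribution n k Q) (q : Q) :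
    TangentSpace (𝓡 n) q →L[ℝ] TangentSpace (𝓡 n) q :=
  haveI : FiniteDimensional ℝ (TangentSpace (𝓡 n) q) :=
    inferInstanceAs (FiniteDimensional ℝ (Model n))
  haveI : T2Space (TangentSpace (𝓡 n) q) := inferInstanceAs (T2Space (Model n))
  LinearMap.toContinuousLinearMap
    (Submodule.projection (W.fiber q) (orthFiber g W q) (isCompl_fiber_orthFiber g W q))

/-- The complementary projector `id - proj`, onto the orthogonal complement of `W`. -/
def coproj (g : SmoothMetric n Q) (W : SmoothDistribution n k Q) (q : Q) :
    TangentSpace (𝓡 n) q →L[ℝ] TangentSpace (𝓡 n) q :=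
  ContinuousLinearMap.id ℝ (TangentSpace (𝓡 n) q) - proj g W q

/-! ### Hamiltonians of mechanical type -/

/-- The Hamiltonian `H(q, p) = g*_q(p, p) / 2 + U(q)`. -/
def hamiltonian (g : SmoothMetric n Q) (U : Q → ℝ) (x : CotangentBundle n Q) : ℝ :=
  (1 / 2) * cometric g x.1 x.2 x.2 + U x.1

/-! ### Local bundle charts

A chart `φ` of `Q` with coordinates `q¹, …, qⁿ` induces the chart `(q, p)` of the cotangent bundle
in which the covector `∑ pᵢ dqⁱ` at the point with coordinates `q` has coordinates `(q, p)`. -/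

section Chart

variable (φ : OpenPartialHomeomorph Q (Model n))

/-- The differential of the chart `φ` at `q`. -/
def chartDiff (q : Q) : TangentSpace (𝓡 n) q →L[ℝ] Model n :=
  mfderiv (𝓡 n) 𝓘(ℝ, Model n) φ q

/-- The coordinate frame of the chart `φ` at `q`: it sends the `i`-th basis vector to `∂/∂qⁱ`. -/
def chartFrame (q : Q) : Model n →L[ℝ] TangentSpace (𝓡 n) q :=
  (chartDiff φ q).inverse

/-- The coordinates `(q, p)` of a point of the cotangent bundle. -/
def bundleCoord (x : CotangentBundle n Q) : Model n × DualModel n :=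
  (φ x.1, x.2.comp (chartFrame φ x.1))

/-- The point of the cotangent bundle with coordinates `(q, p)`. -/
def bundlePoint (q : Model n) (p : DualModel n) : CotangentBundle n Q :=
  ⟨φ.symm q, p.comp (chartDiff φ (φ.symm q))⟩

/-- The coordinates `(q̇, ṗ)` of a tangent vector of the cotangent bundle at `x`. -/
def velocityCoord (x : CotangentBundle n Q) (v : TangentSpace (cotangentModel n) x) :
    Model n × DualModel n :=
  mfderiv (cotangentModel n) 𝓘(ℝ, Model n × DualModel n) (bundleCoord φ) x v

/-- The vector `∂_p H` of the partial derivatives `∂H/∂pᵢ` at `x`. -/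
def partialP (H : CotangentBundle n Q → ℝ) (x : CotangentBundle n Q) : Model n :=
  WithLp.toLp 2 fun i =>
    fderiv ℝ (fun p => H (bundlePoint φ (bundleCoord φ x).1 p)) (bundleCoord φ x).2
      (EuclideanSpace.proj i)

/-- The covector `∂_q H` of the partial derivatives `∂H/∂qⁱ` at `x`. -/
def partialQ (H : CotangentBundle n Q → ℝ) (x : CotangentBundle n Q) : DualModel n :=
  fderiv ℝ (fun q => H (bundlePoint φ q (bundleCoord φ x).2)) (bundleCoord φ x).1

/-- The matrix (as an endomorphism of `ℝⁿ`) of an endomorphism `A` of the tangent space at `q`.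
The transposed matrix acts on covectors by `α ↦ α.comp (chartMatrix φ q A)`. -/
def chartMatrix (q : Q) (A : TangentSpace (𝓡 n) q →L[ℝ] TangentSpace (𝓡 n) q) :
    Model n →L[ℝ] Model n :=
  (chartDiff φ q).comp (A.comp (chartFrame φ q))

end Chart

/-! ### The constrained mechanical system -/

/-- The differential-algebraic relations for the velocity `v = (q̇, ṗ)` at the point `x = (q, p)`,
in every local bundle chart around `x`. -/
structure SatisfiesRelations (g : SmoothMetric n Q) (W : SmoothDistribution n k Q)
    (H : CotangentBundle n Q → ℝ) (x : CotangentBundle n Q)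
    (v : TangentSpace (cotangentModel n) x) : Prop where
  /-- `q̇ = 𝔭 ∂_p H` -/
  qdot : ∀ φ ∈ IsManifold.maximalAtlas (𝓡 n) ∞ Q, x.1 ∈ φ.source →
    (velocityCoord φ x v).1 = chartMatrix φ x.1 (proj g W x.1) (partialP φ H x)
  /-- `𝔭† ṗ = -𝔭† ∂_q H` -/
  pdot : ∀ φ ∈ IsManifold.maximalAtlas (𝓡 n) ∞ Q, x.1 ∈ φ.source →
    (velocityCoord φ x v).2.comp (chartMatrix φ x.1 (proj g W x.1)) =
      -(partialQ φ H x).comp (chartMatrix φ x.1 (proj g W x.1))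
  /-- `𝔭̄ ∂_p H = 0` -/
  constraint : ∀ φ ∈ IsManifold.maximalAtlas (𝓡 n) ∞ Q, x.1 ∈ φ.source →
    chartMatrix φ x.1 (coproj g W x.1) (partialP φ H x) = 0

/-- The physical leaf: the points of the cotangent bundle at which `𝔭̄ ∂_p H = 0`. -/
def physicalLeaf (g : SmoothMetric n Q) (W : SmoothDistribution n k Q)
    (H : CotangentBundle n Q → ℝ) : Set (CotangentBundle n Q) :=
  {x | ∀ φ ∈ IsManifold.maximalAtlas (𝓡 n) ∞ Q, x.1 ∈ φ.source →
    chartMatrix φ x.1 (coproj g W x.1) (partialP φ H x) = 0}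

/-- The vectors tangent to a subset `S` of the cotangent bundle: the velocities at time `0` of the
smooth curves `(-ε, ε) → S`. For a submanifold `S` this is its tangent bundle. -/
def tangentVectors (S : Set (CotangentBundle n Q)) :
    Set (TangentBundle (cotangentModel n) (CotangentBundle n Q)) :=
  {w | ∃ ε > (0 : ℝ), ∃ σ : ℝ → CotangentBundle n Q,
    ContMDiffOn 𝓘(ℝ, ℝ) (cotangentModel n) ∞ σ (Ioo (-ε) ε) ∧
    (∀ s ∈ Ioo (-ε) ε, σ s ∈ S) ∧
    w = ⟨σ 0, mfderiv 𝓘(ℝ, ℝ) (cotangentModel n) σ 0 (1 : ℝ)⟩}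

/-- A vector field along `S` is smooth if near every point of `S` it is the restriction of a smooth
vector field on an open subset of the cotangent bundle. Values outside `S` are irrelevant. -/
def IsSmoothFieldAlong (S : Set (CotangentBundle n Q))
    (X : (x : CotangentBundle n Q) → TangentSpace (cotangentModel n) x) : Prop :=
  ∀ x ∈ S, ∃ V : Set (CotangentBundle n Q), IsOpen V ∧ x ∈ V ∧
    ∃ Y : (y : CotangentBundle n Q) → TangentSpace (cotangentModel n) y,
      ContMDiffOn (cotangentModel n) (cotangentModel n).tangent ∞
        (fun y => (⟨y, Y y⟩ : TangentBundle (cotangentModel n) (CotangentBundle n Q))) V ∧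
      ∀ y ∈ V ∩ S, Y y = X y

/-- A physical orbit on the time interval `J`: a smooth path in the physical leaf whose velocity
satisfies the differential-algebraic relations. The values of `γ` outside `J` are irrelevant. -/
structure IsPhysicalOrbit (g : SmoothMetric n Q) (W : SmoothDistribution n k Q)
    (H : CotangentBundle n Q → ℝ) (J : Set ℝ) (γ : ℝ → CotangentBundle n Q) : Prop where
  smooth : ContMDiffOn 𝓘(ℝ, ℝ) (cotangentModel n) ∞ γ J
  mem_leaf : ∀ t ∈ J, γ t ∈ physicalLeaf g W H
  relations : ∀ t ∈ J, SatisfiesRelations g W H (γ t)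
    (mfderivWithin 𝓘(ℝ, ℝ) (cotangentModel n) γ J t (1 : ℝ))

end Manifold

/-- The half-open time interval `[0, T)`, where `T = ⊤` gives `[0, ∞)`. -/
def timeInterval (T : EReal) : Set ℝ := {t | 0 ≤ t ∧ (t : EReal) < T}

end

end ConstrainedMechanics

open ConstrainedMechanics

namespace ConstrainedMechanics

noncomputable section

set_option linter.unusedSectionVars false

variable {n k : ℕ} {Q : Type*} [TopologicalSpace Q] [ChartedSpace (Model n) Q]
  [IsManifold (𝓡 n) ∞ Q] {φ ψ : OpenPartialHomeomorph Q (Model n)} {q : Q}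
  {g : SmoothMetric n Q} {W : SmoothDistribution n k Q} {U : Q → ℝ}

/-! ### Charts -/

/-! Write `P` for the orthogonal projector in a chart. Since `∂_p H = g⁻¹ p` and the projectors are
`g`-self-adjoint, the constraint says `p = p ∘ P`; this linear condition on the fibres describes the
leaf.

On the leaf the relations fix `q̇ = g⁻¹ p`, but only the part `ṗ ∘ P` of `ṗ`. Tangency supplies the
rest: differentiating `p = p ∘ P` gives `ṗ = p ∘ DP(q̇) + ṗ ∘ P`. This is the formula of
`localField`, smooth because `P` is (`contDiffOn_localProj`), and `eq_localField` is the uniqueness.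
It is consistent with the relations because `P ∘ DP ∘ P = 0`. No submanifold chart of the leaf is
needed for tangency: along any integral curve of `localField`, on the leaf or off it, the defect `p
- p ∘ P` solves a homogeneous linear equation, so it stays zero once it is zero
(`comp_localProj_eq_of_hasDerivAt`).

Independence of the chart comes from restating the relations as `ω(w, w') = dH(w')` for all test
vectors `w'` whose base part lies in `W` (`localRelations_iff_symplectic`), since cotangent lifts
preserve the canonical form `ω` (`symplectic_fderiv`).

Globally, orbits agree on a clopen set of times, so the supremum of all life times carries a maximal
orbit. A local existence time uniform near each point (`exists_local_orbit`) prevents a maximal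
orbit of finite life time from returning to a compact set. Testing the symplectic form of the
relations with the velocity itself gives conservation of energy. If `U` is bounded below, `g*(p,
p)`, which is the squared speed of the base path, is therefore bounded. Over a finite time the base
path is then Lipschitz and, by completeness, converges along a sequence of times; the covectors
remain in a compact set, which contradicts the escape property. -/

theorem chart_mdifferentiable (hφ : φ ∈ IsManifold.maximalAtlas (𝓡 n) ∞ Q) :
    φ.MDifferentiable (𝓡 n) 𝓘(ℝ, Model n) :=
  ⟨(contMDiffOn_of_mem_maximalAtlas hφ).mdifferentiableOn (by simp),
    (contMDiffOn_symm_of_mem_maximalAtlas hφ).mdifferentiableOn (by simp)⟩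

/-- `inverse` takes the value zero on a map that is not invertible. On the source of the chart the
derivative of `φ.symm` is a two-sided inverse, so that default value does not occur there. -/
theorem chartFrame_eq_mfderiv_symm (hφ : φ ∈ IsManifold.maximalAtlas (𝓡 n) ∞ Q)
    (hq : q ∈ φ.source) :
    chartFrame φ q = mfderiv 𝓘(ℝ, Model n) (𝓡 n) φ.symm (φ q) := by
  have h1 := (chart_mdifferentiable hφ).symm_comp_deriv hq
  have h2 := (chart_mdifferentiable hφ).comp_symm_deriv (φ.map_source hq)
  rw [φ.left_inv hq] at h2
  exact ContinuousLinearMap.inverse_eq h2 h1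

theorem chartDiff_comp_chartFrame (hφ : φ ∈ IsManifold.maximalAtlas (𝓡 n) ∞ Q)
    (hq : q ∈ φ.source) : (chartDiff φ q).comp (chartFrame φ q) = .id ℝ _ := by
  rw [chartFrame_eq_mfderiv_symm hφ hq]
  have h2 := (chart_mdifferentiable hφ).comp_symm_deriv (φ.map_source hq)
  rw [φ.left_inv hq] at h2
  exact h2

theorem chartFrame_comp_chartDiff (hφ : φ ∈ IsManifold.maximalAtlas (𝓡 n) ∞ Q)
    (hq : q ∈ φ.source) : (chartFrame φ q).comp (chartDiff φ q) = .id ℝ _ := by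
  rw [chartFrame_eq_mfderiv_symm hφ hq]
  exact (chart_mdifferentiable hφ).symm_comp_deriv hq

theorem chartDiff_chartFrame (hφ : φ ∈ IsManifold.maximalAtlas (𝓡 n) ∞ Q) (hq : q ∈ φ.source)
    (u : Model n) : chartDiff φ q (chartFrame φ q u) = u :=
  DFunLike.congr_fun (chartDiff_comp_chartFrame hφ hq) u

theorem chartFrame_chartDiff (hφ : φ ∈ IsManifold.maximalAtlas (𝓡 n) ∞ Q) (hq : q ∈ φ.source)
    (v : TangentSpace (𝓡 n) q) : chartFrame φ q (chartDiff φ q v) = v :=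
  DFunLike.congr_fun (chartFrame_comp_chartDiff hφ hq) v

/-! ### Smoothness of vector fields along a map, tested in a chart -/

section Sections

variable {E H M : Type*} [NormedAddCommGroup E] [NormedSpace ℝ E] [TopologicalSpace H]
  {J : ModelWithCorners ℝ E H} [TopologicalSpace M] [ChartedSpace H M] {s : Set M} {b : M → Q}

theorem ContMDiffOn.chartDiff_apply (hφ : φ ∈ IsManifold.maximalAtlas (𝓡 n) ∞ Q)
    {v : (m : M) → TangentSpace (𝓡 n) (b m)}
    (hv : ContMDiffOn J (𝓡 n).tangent ∞ (fun m => (⟨b m, v m⟩ : TangentBundle (𝓡 n) Q)) s)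
    (hb : MapsTo b s φ.source) :
    ContMDiffOn J 𝓘(ℝ, Model n) ∞ (fun m => (chartDiff φ (b m) (v m) : Model n)) s := by
  have h1 := (contMDiffOn_of_mem_maximalAtlas hφ).contMDiffOn_tangentMapWithin
    (m := ∞) (by simp) φ.open_source.uniqueMDiffOn
  have h2 := (contMDiff_snd_tangentBundle_modelSpace (n := ∞) (Model n) 𝓘(ℝ, Model n)).comp_contMDiffOn
    (h1.comp hv (fun m hm => hb hm))
  refine h2.congr fun m hm => ?_
  simp only [chartDiff, Function.comp, tangentMapWithin]
  rw [mfderivWithin_of_isOpen φ.open_source (hb hm)]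
  rfl

theorem ContMDiffOn.chartFrame_apply (hφ : φ ∈ IsManifold.maximalAtlas (𝓡 n) ∞ Q)
    (hbs : ContMDiffOn J (𝓡 n) ∞ b s) (hb : MapsTo b s φ.source)
    {u : M → Model n} (hu : ContMDiffOn J 𝓘(ℝ, Model n) ∞ u s) :
    ContMDiffOn J (𝓡 n).tangent ∞
      (fun m => (⟨b m, chartFrame φ (b m) (u m)⟩ : TangentBundle (𝓡 n) Q)) s := by
  have h1 := (contMDiffOn_symm_of_mem_maximalAtlas hφ).contMDiffOn_tangentMapWithin
    (m := ∞) (by simp) φ.open_target.uniqueMDiffOn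
  have h0 : ContMDiffOn J (𝓡 n).tangent ∞
      (fun m => (⟨φ (b m), u m⟩ : TangentBundle (𝓡 n) (Model n))) s := by
    intro m hm
    rw [contMDiffWithinAt_totalSpace]
    refine ⟨((contMDiffOn_of_mem_maximalAtlas hφ).comp hbs hb) m hm, ?_⟩
    simpa using hu m hm
  refine (h1.comp h0 (fun m hm => φ.map_source (hb hm))).congr fun m hm => ?_
  -- The two base points are only propositionally equal, so the base point is generalized before the
  -- dependent pair is compared.
  have key : ∀ q' : Q, q' = b m →
      (⟨b m, chartFrame φ (b m) (u m)⟩ : TangentBundle (𝓡 n) Q) =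
        ⟨q', mfderiv 𝓘(ℝ, Model n) (𝓡 n) φ.symm (φ (b m)) (u m)⟩ := by
    rintro _ rfl
    rw [chartFrame_eq_mfderiv_symm hφ (hb hm)]
    rfl
  simp only [Function.comp, tangentMapWithin]
  rw [mfderivWithin_of_isOpen φ.open_target (φ.map_source (hb hm))]
  exact key _ (φ.left_inv (hb hm))

end Sections

/-- A basis of `F` identifies `F →L[ℝ] G` with a finite power of `G`, where smoothness is
componentwise. -/
theorem contMDiffOn_clm_of_apply {E H M F G : Type*} [NormedAddCommGroup E] [NormedSpace ℝ E]
    [TopologicalSpace H] {J : ModelWithCorners ℝ E H} [TopologicalSpace M] [ChartedSpace H M]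
    {s : Set M} [NormedAddCommGroup F] [NormedSpace ℝ F] [FiniteDimensional ℝ F]
    [NormedAddCommGroup G] [NormedSpace ℝ G] {f : M → F →L[ℝ] G}
    (h : ∀ u, ContMDiffOn J 𝓘(ℝ, G) ∞ (fun m => f m u) s) :
    ContMDiffOn J 𝓘(ℝ, F →L[ℝ] G) ∞ f s := by
  let e₁ := ContinuousLinearEquiv.ofFinrankEq (Module.finrank_fin_fun ℝ (n := Module.finrank ℝ F)).symm
  let e₂ := (e₁.arrowCongr (1 : G ≃L[ℝ] G)).trans
    (ContinuousLinearEquiv.piRing (Fin (Module.finrank ℝ F)))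
  have h2 : ContMDiffOn J 𝓘(ℝ, Fin (Module.finrank ℝ F) → G) ∞ (fun m => e₂ (f m)) s :=
    contMDiffOn_pi_space.2 fun i => h _
  refine (e₂.symm.contDiff.contMDiff.comp_contMDiffOn h2).congr fun m _ => ?_
  exact (e₂.symm_apply_apply (f m)).symm

/-! ### Bundle charts -/

theorem contMDiffOn_bundleCoord (hφ : φ ∈ IsManifold.maximalAtlas (𝓡 n) ∞ Q) :
    ContMDiffOn (cotangentModel n) 𝓘(ℝ, Model n × DualModel n) ∞ (bundleCoord φ)
      (TotalSpace.proj ⁻¹' φ.source : Set (CotangentBundle n Q)) := by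
  have hproj : ContMDiffOn (cotangentModel n) (𝓡 n) ∞
      (fun x : CotangentBundle n Q => x.1) (TotalSpace.proj ⁻¹' φ.source) :=
    (contMDiff_proj _).contMDiffOn
  refine ContMDiffOn.prodMk_space ((contMDiffOn_of_mem_maximalAtlas hφ).comp hproj fun x hx => hx) ?_
  refine contMDiffOn_clm_of_apply fun u => ?_
  have h1 : ContMDiffOn (cotangentModel n) ((𝓡 n).prod 𝓘(ℝ, ℝ)) ∞
      (fun x : CotangentBundle n Q =>
        (TotalSpace.mk' ℝ x.1 (x.2 (chartFrame φ x.1 u)) : TotalSpace ℝ (Trivial Q ℝ)))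
      (TotalSpace.proj ⁻¹' φ.source) :=
    ContMDiffOn.clm_bundle_apply contMDiff_id.contMDiffOn
      (ContMDiffOn.chartFrame_apply hφ hproj (fun x hx => hx) contMDiffOn_const)
  intro x hx
  exact ((contMDiffWithinAt_totalSpace).1 (h1 x hx)).2

theorem contMDiffOn_bundlePoint (hφ : φ ∈ IsManifold.maximalAtlas (𝓡 n) ∞ Q) :
    ContMDiffOn 𝓘(ℝ, Model n × DualModel n) (cotangentModel n) ∞
      (fun y : Model n × DualModel n => (bundlePoint φ y.1 y.2 : CotangentBundle n Q))
      (φ.target ×ˢ univ) := by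
  intro y hy
  -- Smoothness into the bundle of linear maps is tested in the trivialization `e` at the base
  -- point: the covector is applied to the smooth local vector field that is constantly `u` in `e`.
  set e := trivializationAt (Model n) (TangentSpace (𝓡 n)) (φ.symm y.1)
  let S : Set (Model n × DualModel n) := (φ.target ∩ φ.symm ⁻¹' e.baseSet) ×ˢ univ
  have hSo : IsOpen S := (φ.isOpen_inter_preimage_symm e.open_baseSet).prod isOpen_univ
  have hyS : y ∈ S := 
    ⟨⟨hy.1, mem_baseSet_trivializationAt (Model n) (TangentSpace (𝓡 n)) (φ.symm y.1)⟩, mem_univ _⟩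
  have hfst : ContMDiffOn 𝓘(ℝ, Model n × DualModel n) (𝓡 n) ∞
      (fun y : Model n × DualModel n => φ.symm y.1) (φ.target ×ˢ univ) :=
    (contMDiffOn_symm_of_mem_maximalAtlas hφ).comp contDiff_fst.contMDiff.contMDiffOn
      fun x hx => hx.1
  rw [contMDiffWithinAt_hom_bundle]
  refine ⟨hfst y hy, ?_⟩
  have key : ContMDiffOn 𝓘(ℝ, Model n × DualModel n) 𝓘(ℝ, Model n →L[ℝ] ℝ) ∞
      (fun z : Model n × DualModel n =>
        ContinuousLinearMap.inCoordinates (Model n) (TangentSpace (𝓡 n)) ℝ (Trivial Q ℝ)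
          (φ.symm y.1) (φ.symm z.1) (φ.symm y.1) (φ.symm z.1)
          (bundlePoint φ z.1 z.2 : CotangentBundle n Q).2) S := by
    refine contMDiffOn_clm_of_apply fun u => ?_
    have hsec : ContMDiffOn 𝓘(ℝ, Model n × DualModel n) (𝓡 n).tangent ∞
        (fun z : Model n × DualModel n =>
          (⟨φ.symm z.1, e.symmL ℝ (φ.symm z.1) u⟩ : TangentBundle (𝓡 n) Q)) S := by
      have h1 : ContMDiffOn 𝓘(ℝ, Model n × DualModel n) ((𝓡 n).prod 𝓘(ℝ, Model n)) ∞
          (fun z : Model n × DualModel n => (φ.symm z.1, u)) S :=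
        (hfst.mono fun z hz => ⟨hz.1.1, mem_univ _⟩).prodMk contMDiffOn_const
      refine ((e.contMDiffOn_symm (IB := 𝓡 n) (n := ∞)).comp h1 fun z hz =>
        e.mem_target.2 hz.1.2).congr fun z hz => ?_
      rw [Function.comp, ← e.mk_symm hz.1.2, e.symmL_apply hz.1.2]
    have hd := ContMDiffOn.chartDiff_apply hφ hsec fun z hz => φ.map_target hz.1.1
    refine ((contDiff_snd.contMDiff (n := ∞)).contMDiffOn.clm_apply hd).congr fun z hz => ?_
    simp [ContinuousLinearMap.inCoordinates, bundlePoint, e]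
  exact (key y hyS).contMDiffAt (hSo.mem_nhds hyS) |>.contMDiffWithinAt

/-! ### Orthogonal projectors and the induced metric -/

instance (q : Q) : FiniteDimensional ℝ (TangentSpace (𝓡 n) q) :=
  inferInstanceAs (FiniteDimensional ℝ (Model n))

instance (q : Q) : T2Space (TangentSpace (𝓡 n) q) := inferInstanceAs (T2Space (Model n))

theorem sub_proj_mem (v : TangentSpace (𝓡 n) q) : v - proj g W q v ∈ orthFiber g W q := by
  have : FiniteDimensional ℝ (TangentSpace (𝓡 n) q) := inferInstance
  have h : proj g W q v = Submodule.projection (W.fiber q) (orthFiber g W q)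
    (isCompl_fiber_orthFiber g W q) v := rfl
  rw [h, ← Submodule.projection_apply_eq_zero_iff (isCompl_fiber_orthFiber g W q), map_sub,
    Submodule.projection_apply_of_mem_left _ (Submodule.projection_apply_mem _ v), sub_self]

theorem proj_mem (v : TangentSpace (𝓡 n) q) : proj g W q v ∈ W.fiber q := by
  exact Submodule.projection_apply_mem (isCompl_fiber_orthFiber g W q) v

theorem inner_eq_zero_of_mem {w v : TangentSpace (𝓡 n) q} (hw : w ∈ W.fiber q)
    (hv : v ∈ orthFiber g W q) : g.inner q w v = 0 := hv w hw

theorem proj_eq_of_mem {v w : TangentSpace (𝓡 n) q} (hw : w ∈ W.fiber q)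
    (hv : v - w ∈ orthFiber g W q) : proj g W q v = w := by
  have h1 : proj g W q w = w :=
    Submodule.projection_apply_of_mem_left (isCompl_fiber_orthFiber g W q) hw
  have h2 : proj g W q (v - w) = 0 :=
    (Submodule.projection_apply_eq_zero_iff (isCompl_fiber_orthFiber g W q)).2 hv
  rwa [map_sub, h1, sub_eq_zero] at h2

theorem proj_of_mem {v : TangentSpace (𝓡 n) q} (hv : v ∈ W.fiber q) : proj g W q v = v :=
  proj_eq_of_mem hv (by simp)

theorem proj_proj (v : TangentSpace (𝓡 n) q) : proj g W q (proj g W q v) = proj g W q v :=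
  proj_of_mem (proj_mem v)

/-- Both sides equal `g(𝔭 v, 𝔭 w)`. -/
theorem inner_proj_left (v w : TangentSpace (𝓡 n) q) :
    g.inner q (proj g W q v) w = g.inner q v (proj g W q w) := by
  have h1 := inner_eq_zero_of_mem (proj_mem (g := g) (W := W) v) (sub_proj_mem (g := g) w)
  have h2 := inner_eq_zero_of_mem (proj_mem (g := g) (W := W) w) (sub_proj_mem (g := g) v)
  rw [map_sub, sub_eq_zero] at h1 h2
  rw [h1, g.symm q v, h2, g.symm]

theorem sharp_inner (v : TangentSpace (𝓡 n) q) : sharp g q (g.inner q v) = v := by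
  by_contra hne
  have h := g.pos q _ (sub_ne_zero.2 hne)
  have h0 : g.inner q (sharp g q (g.inner q v) - v) = 0 := by rw [map_sub, inner_sharp, sub_self]
  rw [h0] at h
  exact lt_irrefl _ h

theorem apply_eq_inner_sharp (α : CotangentSpace n q) (v : TangentSpace (𝓡 n) q) :
    α v = g.inner q (sharp g q α) v := by rw [inner_sharp]

theorem apply_sharp_comm (α β : CotangentSpace n q) : α (sharp g q β) = β (sharp g q α) := by
  rw [apply_eq_inner_sharp (g := g) α, apply_eq_inner_sharp (g := g) β, g.symm]

/-- Self-adjointness turns `α ∘ 𝔭̄` into the covector `g(𝔭̄ α♯, ·)`, and `g` is definite. This is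
the content of the first statement of the theorem. -/
theorem coproj_sharp_eq_zero_iff (α : CotangentSpace n q) :
    coproj g W q (sharp g q α) = 0 ↔ α.comp (coproj g W q) = 0 := by
  have key : ∀ v, α (coproj g W q v) = g.inner q (coproj g W q (sharp g q α)) v := by
    intro v
    rw [apply_eq_inner_sharp (g := g) α]
    simp [coproj, inner_proj_left]
  constructor
  · intro h
    ext v
    rw [ContinuousLinearMap.comp_apply, key, h]
    simp
  · intro h
    by_contra hne
    have h' := g.pos q _ hne
    rw [← key, ← ContinuousLinearMap.comp_apply, h] at h'
    exact lt_irrefl _ h'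

theorem cometric_self (α : CotangentSpace n q) : cometric g q α α = α (sharp g q α) := by
  rw [cometric, inner_sharp]

/-- Cauchy–Schwarz, from the discriminant of `t ↦ g(a + t v, a + t v)` with `a = α♯`. It later
converts an energy bound into a bound on the coordinates of a covector. -/
theorem sq_apply_le (α : CotangentSpace n q) (v : TangentSpace (𝓡 n) q) :
    (α v) ^ 2 ≤ cometric g q α α * g.inner q v v := by
  have hnn : ∀ w, 0 ≤ g.inner q w w := fun w => by
    rcases eq_or_ne w 0 with rfl | hw
    · simp
    · exact (g.pos q w hw).le
  rw [apply_eq_inner_sharp (g := g) α v, cometric]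
  set a := sharp g q α
  have h := discrim_le_zero (a := g.inner q v v) (b := 2 * g.inner q a v) (c := g.inner q a a)
    fun t => by
      have := hnn (a + t • v)
      simp only [map_add, map_smul, _root_.add_apply, _root_.smul_apply,
        smul_eq_mul, g.symm q v a] at this
      linarith
  rw [discrim] at h
  linarith

/-! ### Local expressions of the metric and the projector -/

/-- The metric in the coordinates of the chart `φ`. -/
def localMetric (g : SmoothMetric n Q) (φ : OpenPartialHomeomorph Q (Model n)) (z : Model n) :
    Model n →L[ℝ] DualModel n :=
  (ContinuousLinearMap.precomp ℝ (chartFrame φ (φ.symm z))).comp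
    ((g.inner (φ.symm z)).comp (chartFrame φ (φ.symm z)))

theorem localMetric_apply (z u v : Model n) : localMetric g φ z u v =
    g.inner (φ.symm z) (chartFrame φ (φ.symm z) u) (chartFrame φ (φ.symm z) v) := rfl

/-- The inverse metric in the coordinates of the chart `φ`. -/
def localSharp (g : SmoothMetric n Q) (φ : OpenPartialHomeomorph Q (Model n)) (z : Model n) :
    DualModel n →L[ℝ] Model n :=
  (chartDiff φ (φ.symm z)).comp
    ((sharp g (φ.symm z)).comp (ContinuousLinearMap.precomp ℝ (chartDiff φ (φ.symm z))))

/-- The projector onto the distribution in the coordinates of the chart `φ`. -/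
def localProj (g : SmoothMetric n Q) (W : SmoothDistribution n k Q)
    (φ : OpenPartialHomeomorph Q (Model n)) (z : Model n) : Model n →L[ℝ] Model n :=
  chartMatrix φ (φ.symm z) (proj g W (φ.symm z))

theorem contDiffOn_localMetric (hφ : φ ∈ IsManifold.maximalAtlas (𝓡 n) ∞ Q) :
    ContDiffOn ℝ ∞ (localMetric g φ) φ.target := by
  refine contDiffOn_clm_apply.2 fun u => contDiffOn_clm_apply.2 fun v => ?_
  rw [← contMDiffOn_iff_contDiffOn]
  have hs := contMDiffOn_symm_of_mem_maximalAtlas hφ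
  have hm : MapsTo φ.symm φ.target φ.source := fun z hz => φ.map_target hz
  have hu := ContMDiffOn.chartFrame_apply hφ hs hm (contMDiffOn_const (c := u))
  have hv := ContMDiffOn.chartFrame_apply hφ hs hm (contMDiffOn_const (c := v))
  have h := ContMDiffOn.clm_bundle_apply₂ (E₃ := Trivial Q ℝ) (F₃ := ℝ)
    (g.contMDiff.comp_contMDiffOn hs) hu hv
  intro z hz
  exact ((contMDiffWithinAt_totalSpace).1 (h z hz)).2

theorem localMetric_localSharp (hφ : φ ∈ IsManifold.maximalAtlas (𝓡 n) ∞ Q) {z : Model n}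
    (hz : z ∈ φ.target) (p : DualModel n) : localMetric g φ z (localSharp g φ z p) = p := by
  ext v
  have hq := φ.map_target hz
  rw [localMetric_apply, localSharp]
  simp only [ContinuousLinearMap.comp_apply, chartFrame_chartDiff hφ hq, inner_sharp]
  exact congrArg p (chartDiff_chartFrame hφ hq v)

theorem localSharp_localMetric (hφ : φ ∈ IsManifold.maximalAtlas (𝓡 n) ∞ Q) {z : Model n}
    (hz : z ∈ φ.target) (u : Model n) : localSharp g φ z (localMetric g φ z u) = u := by
  have hq := φ.map_target hz
  have h : (ContinuousLinearMap.precomp ℝ (chartDiff φ (φ.symm z))) (localMetric g φ z u) =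
      g.inner (φ.symm z) (chartFrame φ (φ.symm z) u) := by
    ext v
    exact congrArg _ (chartFrame_chartDiff hφ hq v)
  rw [localSharp, ContinuousLinearMap.comp_apply, ContinuousLinearMap.comp_apply, h, sharp_inner,
    chartDiff_chartFrame hφ hq]

/-- The inverse of a smooth family of invertible operators is smooth. -/
theorem contDiffOn_localSharp (hφ : φ ∈ IsManifold.maximalAtlas (𝓡 n) ∞ Q) :
    ContDiffOn ℝ ∞ (localSharp g φ) φ.target := by
  have key : ∀ z ∈ φ.target, ∃ e : Model n ≃L[ℝ] DualModel n,
      (e : Model n →L[ℝ] DualModel n) = localMetric g φ z ∧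
      (e.symm : DualModel n →L[ℝ] Model n) = localSharp g φ z := fun z hz =>
    ⟨ContinuousLinearEquiv.equivOfInverse _ _ (localSharp_localMetric (g := g) hφ hz)
      (localMetric_localSharp hφ hz), rfl, rfl⟩
  intro z hz
  obtain ⟨e, he, -⟩ := key z hz
  refine (ContDiffAt.comp_contDiffWithinAt z (he ▸ contDiffAt_map_inverse e)
    (contDiffOn_localMetric hφ z hz)).congr_of_mem (fun z' hz' => ?_) hz
  obtain ⟨e', he', hs⟩ := key z' hz'
  rw [← hs, Function.comp, ← he', ContinuousLinearMap.inverse_equiv]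

/-! ### Smoothness of the orthogonal projector, from Gram matrices -/

theorem exists_equiv_of_injective_dual {F : Type*} [NormedAddCommGroup F] [NormedSpace ℝ F]
    [FiniteDimensional ℝ F] {D : F →L[ℝ] F →L[ℝ] ℝ} (hD : Function.Injective D) :
    ∃ e : F ≃L[ℝ] (F →L[ℝ] ℝ), (e : F →L[ℝ] F →L[ℝ] ℝ) = D :=
  have hfin : Module.finrank ℝ F = Module.finrank ℝ (F →L[ℝ] ℝ) :=
    ((LinearMap.toContinuousLinearMap (𝕜 := ℝ) (E := F)
      (F' := ℝ)).finrank_eq.symm.trans Subspace.dual_finrank_eq).symm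
  ⟨(LinearEquiv.ofInjectiveOfFinrankEq (D : F →ₗ[ℝ] (F →L[ℝ] ℝ)) hD hfin).toContinuousLinearEquiv,
    by ext; rfl⟩

/-- For a frame `B` and a metric `G` the operator is `B (Bᵀ G B)⁻¹ Bᵀ G`, the orthogonal projector
onto the range of `B`. Injectivity of the Gram operator `Bᵀ G B` suffices, because its source and
target have the same dimension. -/
theorem contDiffOn_gramInverse {X E F : Type*} [NormedAddCommGroup X] [NormedSpace ℝ X]
    [NormedAddCommGroup E] [NormedSpace ℝ E] [FiniteDimensional ℝ E] [NormedAddCommGroup F]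
    [NormedSpace ℝ F] [FiniteDimensional ℝ F] {N : Set X} {B : X → F →L[ℝ] E}
    {G : X → E →L[ℝ] E →L[ℝ] ℝ} (hB : ContDiffOn ℝ ∞ B N) (hG : ContDiffOn ℝ ∞ G N)
    (hinj : ∀ z ∈ N, Function.Injective
      (((ContinuousLinearMap.precomp ℝ (B z)).comp (G z)).comp (B z))) :
    ContDiffOn ℝ ∞ (fun z => (B z).comp
      ((((ContinuousLinearMap.precomp ℝ (B z)).comp (G z)).comp (B z)).inverse.comp
        ((ContinuousLinearMap.precomp ℝ (B z)).comp (G z)))) N := by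
  have : CompleteSpace F := FiniteDimensional.complete ℝ F
  have hT : ContDiffOn ℝ ∞ (fun z => (ContinuousLinearMap.precomp ℝ (B z)).comp (G z)) N :=
    contDiffOn_clm_apply.2 fun u => contDiffOn_clm_apply.2 fun c =>
      (hG.clm_apply contDiffOn_const).clm_apply (hB.clm_apply contDiffOn_const)
  have hinv : ContDiffOn ℝ ∞ (fun z =>
      (((ContinuousLinearMap.precomp ℝ (B z)).comp (G z)).comp (B z)).inverse) N := fun z hz => by
    obtain ⟨e, he⟩ := exists_equiv_of_injective_dual (hinj z hz)
    exact ContDiffAt.comp_contDiffWithinAt (g := ContinuousLinearMap.inverse) z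
      (he ▸ contDiffAt_map_inverse e) ((hT.clm_comp hB) z hz)
  exact hB.clm_comp (hinv.clm_comp hT)

theorem contDiffOn_localProj (hφ : φ ∈ IsManifold.maximalAtlas (𝓡 n) ∞ Q) :
    ContDiffOn ℝ ∞ (localProj g W φ) φ.target := by
  intro z₀ hz₀
  obtain ⟨V, hV, Y, hY, hspan⟩ := W.exists_frame (φ.symm z₀)
  let N : Set (Model n) := φ.target ∩ φ.symm ⁻¹' interior V
  have hN : IsOpen N := φ.isOpen_inter_preimage_symm isOpen_interior
  have hzN : z₀ ∈ N := ⟨hz₀, mem_interior_iff_mem_nhds.2 hV⟩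
  let y : Fin k → Model n → Model n := fun i z => chartDiff φ (φ.symm z) (Y i (φ.symm z))
  have hy : ∀ i, ContDiffOn ℝ ∞ (y i) N := fun i => by
    rw [← contMDiffOn_iff_contDiffOn]
    exact ContMDiffOn.chartDiff_apply hφ ((hY i).comp
      ((contMDiffOn_symm_of_mem_maximalAtlas hφ).mono fun z hz => hz.1)
      fun z hz => interior_subset (s := V) hz.2) fun z hz => φ.map_target hz.1
  let B : Model n → (Fin k → ℝ) →L[ℝ] Model n := fun z =>
    ∑ i, (ContinuousLinearMap.proj (R := ℝ) (φ := fun _ : Fin k => ℝ) i).smulRight (y i z)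
  have hBapp : ∀ z c, B z c = ∑ i, c i • y i z := fun z c => by
    simp [B]
  have hframe : ∀ z ∈ N, ∀ c, chartFrame φ (φ.symm z) (B z c) = ∑ i, c i • Y i (φ.symm z) := by
    intro z hz c
    rw [hBapp, map_sum]
    refine Finset.sum_congr rfl fun i _ => ?_
    rw [map_smul, chartFrame_chartDiff hφ (φ.map_target hz.1)]
  have hB : ContDiffOn ℝ ∞ B N := contDiffOn_clm_apply.2 fun c => by
    simp only [hBapp]
    exact ContDiffOn.sum fun i _ => (contDiffOn_const (c := c i)).smul (hy i)
  have hG : ContDiffOn ℝ ∞ (localMetric g φ) N :=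
    (contDiffOn_localMetric hφ).mono fun z hz => hz.1
  let T : Model n → Model n →L[ℝ] (Fin k → ℝ) →L[ℝ] ℝ := fun z =>
    (ContinuousLinearMap.precomp ℝ (B z)).comp (localMetric g φ z)
  let D : Model n → (Fin k → ℝ) →L[ℝ] (Fin k → ℝ) →L[ℝ] ℝ := fun z => (T z).comp (B z)
  -- A kernel vector `c` gives `g(Bc, Bc) = 0`, so `Bc = 0` by definiteness and `c = 0` by
  -- independence of the frame.
  have hinj : ∀ z ∈ N, Function.Injective (D z) := by
    intro z hz
    rw [injective_iff_map_eq_zero]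
    intro c hc
    have h0 : chartFrame φ (φ.symm z) (B z c) = 0 := by
      by_contra hne
      have h := g.pos _ _ hne
      rw [← localMetric_apply] at h
      exact h.ne' (DFunLike.congr_fun hc c)
    rw [hframe z hz] at h0
    exact funext (Fintype.linearIndependent_iff.1 (hspan _ (interior_subset (s := V) hz.2)).1 c h0)
  have hfinal := contDiffOn_gramInverse hB hG hinj
  refine ((hfinal.contDiffAt (hN.mem_nhds hzN)).congr_of_eventuallyEq ?_).contDiffWithinAt
  filter_upwards [hN.mem_nhds hzN] with z hz
  obtain ⟨e, he⟩ := exists_equiv_of_injective_dual (hinj z hz)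
  ext1 u
  -- `c` solves the normal equations, so `Bc` lies in `W` and `u - Bc` is orthogonal to each vector
  -- of the frame.
  set c := (D z).inverse (T z u) with hc
  have hDc : D z c = T z u := by
    rw [hc, ← he, ContinuousLinearMap.inverse_equiv]
    exact e.apply_symm_apply _
  have hproj : proj g W (φ.symm z) (chartFrame φ (φ.symm z) u) =
      chartFrame φ (φ.symm z) (B z c) := by
    have hs := (hspan _ (interior_subset (s := V) hz.2)).2
    refine proj_eq_of_mem ?_ fun w hw => ?_
    · rw [← hs, hframe z hz]
      exact Submodule.sum_mem _ fun i _ => Submodule.smul_mem _ _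
        (Submodule.subset_span (mem_range_self i))
    · rw [← hs] at hw
      obtain ⟨d, rfl⟩ := (Submodule.mem_span_range_iff_exists_fun ℝ).1 hw
      have h1 : localMetric g φ z (B z c) (B z d) = localMetric g φ z u (B z d) :=
        DFunLike.congr_fun hDc d
      rw [← hframe z hz]
      change g.inner _ _ _ = 0
      rw [g.symm, map_sub, _root_.sub_apply, ← localMetric_apply, ← localMetric_apply,
        h1, sub_self]
  change chartDiff φ _ (proj g W (φ.symm z) (chartFrame φ (φ.symm z) u)) = B z c
  rw [hproj, chartDiff_chartFrame hφ (φ.map_target hz.1)]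

/-! ### Bundle charts as local homeomorphisms -/

theorem bundleCoord_bundlePoint (hφ : φ ∈ IsManifold.maximalAtlas (𝓡 n) ∞ Q)
    {y : Model n × DualModel n} (hy : y.1 ∈ φ.target) :
    bundleCoord φ (bundlePoint φ y.1 y.2) = y := by
  refine Prod.ext (φ.right_inv hy) ?_
  ext u
  exact congrArg y.2 (chartDiff_chartFrame hφ (φ.map_target hy) u)

theorem bundlePoint_bundleCoord (hφ : φ ∈ IsManifold.maximalAtlas (𝓡 n) ∞ Q)
    {x : CotangentBundle n Q} (hx : x.1 ∈ φ.source) :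
    bundlePoint φ (bundleCoord φ x).1 (bundleCoord φ x).2 = x := by
  obtain ⟨q, p⟩ := x
  have key : ∀ q' : Q, q' = q →
      (⟨q', (p.comp (chartFrame φ q)).comp (chartDiff φ q')⟩ : CotangentBundle n Q) = ⟨q, p⟩ := by
    rintro _ rfl
    rw [ContinuousLinearMap.comp_assoc, chartFrame_comp_chartDiff hφ hx,
      ContinuousLinearMap.comp_id]
  exact key _ (φ.left_inv hx)

/-- The bundle chart induced by `φ`, as a local homeomorphism. -/
def bundleChart (φ : OpenPartialHomeomorph Q (Model n))
    (hφ : φ ∈ IsManifold.maximalAtlas (𝓡 n) ∞ Q) :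
    OpenPartialHomeomorph (CotangentBundle n Q) (Model n × DualModel n) where
  toFun := bundleCoord φ
  invFun y := bundlePoint φ y.1 y.2
  source := TotalSpace.proj ⁻¹' φ.source
  target := φ.target ×ˢ univ
  map_source' _ hx := ⟨φ.map_source hx, mem_univ _⟩
  map_target' _ hy := φ.map_target hy.1
  left_inv' _ hx := bundlePoint_bundleCoord hφ hx
  right_inv' _ hy := bundleCoord_bundlePoint hφ hy.1
  open_source := φ.open_source.preimage (FiberBundle.continuous_proj _ _)
  open_target := φ.open_target.prod isOpen_univ
  continuousOn_toFun := (contMDiffOn_bundleCoord hφ).continuousOn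
  continuousOn_invFun := (contMDiffOn_bundlePoint hφ).continuousOn

theorem bundleChart_mdifferentiable (hφ : φ ∈ IsManifold.maximalAtlas (𝓡 n) ∞ Q) :
    (bundleChart φ hφ).MDifferentiable (cotangentModel n) 𝓘(ℝ, Model n × DualModel n) :=
  ⟨(contMDiffOn_bundleCoord hφ).mdifferentiableOn (by simp),
    (contMDiffOn_bundlePoint hφ).mdifferentiableOn (by simp)⟩

theorem velocityCoord_bijective (hφ : φ ∈ IsManifold.maximalAtlas (𝓡 n) ∞ Q)
    {x : CotangentBundle n Q} (hx : x.1 ∈ φ.source) :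
    Function.Bijective (velocityCoord φ x) :=
  (bundleChart_mdifferentiable hφ).mfderiv_bijective hx

/-- The change of bundle charts. -/
def bundleTransition (φ ψ : OpenPartialHomeomorph Q (Model n)) (y : Model n × DualModel n) :
    Model n × DualModel n :=
  bundleCoord ψ (bundlePoint φ y.1 y.2 : CotangentBundle n Q)

theorem contDiffAt_bundleTransition (hφ : φ ∈ IsManifold.maximalAtlas (𝓡 n) ∞ Q)
    (hψ : ψ ∈ IsManifold.maximalAtlas (𝓡 n) ∞ Q) {y : Model n × DualModel n}
    (hy : y.1 ∈ φ.target) (hy' : φ.symm y.1 ∈ ψ.source) :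
    ContDiffAt ℝ ∞ (bundleTransition φ ψ) y := by
  rw [← contMDiffAt_iff_contDiffAt]
  have h1 := (contMDiffOn_bundlePoint hφ).contMDiffAt
    ((bundleChart φ hφ).open_target.mem_nhds (x := y) ⟨hy, mem_univ _⟩)
  have h2 := (contMDiffOn_bundleCoord hψ).contMDiffAt
    ((bundleChart ψ hψ).open_source.mem_nhds
      (x := (bundlePoint φ y.1 y.2 : CotangentBundle n Q)) hy')
  exact h2.comp y h1

theorem velocityCoord_eq_fderiv_bundleTransition (hφ : φ ∈ IsManifold.maximalAtlas (𝓡 n) ∞ Q)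
    (hψ : ψ ∈ IsManifold.maximalAtlas (𝓡 n) ∞ Q) {x : CotangentBundle n Q} (hx : x.1 ∈ φ.source)
    (hx' : x.1 ∈ ψ.source) (v : TangentSpace (cotangentModel n) x) :
    velocityCoord ψ x v =
      fderiv ℝ (bundleTransition φ ψ) (bundleCoord φ x) (velocityCoord φ x v) := by
  have h0 : (bundleCoord ψ : CotangentBundle n Q → _) =ᶠ[𝓝 x]
      bundleTransition φ ψ ∘ bundleCoord φ := by
    filter_upwards [(bundleChart φ hφ).open_source.mem_nhds hx] with x' hx'
    rw [Function.comp, bundleTransition, bundlePoint_bundleCoord hφ hx']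
  have hF : MDifferentiableAt 𝓘(ℝ, Model n × DualModel n) 𝓘(ℝ, Model n × DualModel n)
      (bundleTransition φ ψ) (bundleCoord φ x) :=
    ((contDiffAt_bundleTransition hφ hψ (φ.map_source hx)
      ((φ.left_inv hx).symm ▸ hx')).differentiableAt (by simp)).mdifferentiableAt
  have h1 := (bundleChart_mdifferentiable hφ).mdifferentiableAt hx
  rw [velocityCoord, h0.mfderiv_eq]
  rw [mfderiv_comp x hF h1, mfderiv_eq_fderiv]
  rfl

/-! ### The canonical symplectic form is preserved by changes of bundle charts -/

theorem fderiv_fst_of_eventually {E E' : Type*} [NormedAddCommGroup E] [NormedSpace ℝ E]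
    [NormedAddCommGroup E'] [NormedSpace ℝ E'] {f : E → E} {F : E × E' → E × E'} {y : E × E'}
    (hf : DifferentiableAt ℝ f y.1) (hF : DifferentiableAt ℝ F y)
    (h1 : ∀ᶠ z in 𝓝 y, (F z).1 = f z.1) (w : E × E') :
    (fderiv ℝ F y w).1 = fderiv ℝ f y.1 w.1 := by
  have ha := hF.hasFDerivAt.fst
  have hb : HasFDerivAt (𝕜 := ℝ) (fun z : E × E' => f z.1) _ y :=
    HasFDerivAt.comp (g := f) y hf.hasFDerivAt hasFDerivAt_fst
  have := (ha.congr_of_eventuallyEq (h1.mono fun z hz => hz.symm)).unique hb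
  exact DFunLike.congr_fun this w

/-- `h1` and `h2` say that `F` is the cotangent lift of `f`. Differentiating `h2` in the direction
`w` gives `p'(D²f(w₁, u)) + (DF w)₂(Df u) = w₂(u)`, where `p'` is the covector part of `F y`. After
antisymmetrization the second derivatives cancel by symmetry. -/
theorem symplectic_fderiv {E : Type*} [NormedAddCommGroup E] [NormedSpace ℝ E]
    {f : E → E} {F : E × (E →L[ℝ] ℝ) → E × (E →L[ℝ] ℝ)} {y : E × (E →L[ℝ] ℝ)}
    (hf : ContDiffAt ℝ 2 f y.1) (hF : DifferentiableAt ℝ F y)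
    (h1 : ∀ᶠ z in 𝓝 y, (F z).1 = f z.1)
    (h2 : ∀ᶠ z in 𝓝 y, (F z).2.comp (fderiv ℝ f z.1) = z.2) (v w : E × (E →L[ℝ] ℝ)) :
    (fderiv ℝ F y w).2 (fderiv ℝ F y v).1 - (fderiv ℝ F y v).2 (fderiv ℝ F y w).1 =
      w.2 v.1 - v.2 w.1 := by
  have hFd := hF.hasFDerivAt
  have h1' := fderiv_fst_of_eventually (hf.differentiableAt (by simp)) hF h1
  have hdf : HasFDerivAt (fun z : E × (E →L[ℝ] ℝ) => fderiv ℝ f z.1)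
      ((fderiv ℝ (fderiv ℝ f) y.1).comp (ContinuousLinearMap.fst ℝ E (E →L[ℝ] ℝ))) y :=
    ((hf.fderiv_right (m := 1) (by norm_num)).differentiableAt (by simp)).hasFDerivAt.comp y
      hasFDerivAt_fst
  have h2' : ∀ w u, (F y).2 (fderiv ℝ (fderiv ℝ f) y.1 w.1 u) +
      (fderiv ℝ F y w).2 (fderiv ℝ f y.1 u) = w.2 u := fun w u => by
    have ha := hFd.snd.clm_comp hdf
    have hb : HasFDerivAt (𝕜 := ℝ) (fun z : E × (E →L[ℝ] ℝ) => z.2) _ y := hasFDerivAt_snd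
    have := (ha.congr_of_eventuallyEq (h2.mono fun z hz => hz.symm)).unique hb
    exact DFunLike.congr_fun (DFunLike.congr_fun this w) u
  have hsymm : fderiv ℝ (fderiv ℝ f) y.1 v.1 w.1 = fderiv ℝ (fderiv ℝ f) y.1 w.1 v.1 :=
    hf.isSymmSndFDerivAt (by simp) v.1 w.1
  rw [h1', h1']
  linear_combination h2' w v.1 - h2' v w.1 + congrArg (F y).2 hsymm

/-! ### The Hamiltonian in a bundle chart -/

/-- The Hamiltonian in the coordinates of a bundle chart. -/
def localHamiltonian (g : SmoothMetric n Q) (U : Q → ℝ) (φ : OpenPartialHomeomorph Q (Model n))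
    (y : Model n × DualModel n) : ℝ :=
  hamiltonian g U (bundlePoint φ y.1 y.2)

theorem localHamiltonian_eq (y : Model n × DualModel n) :
    localHamiltonian g U φ y = (1 / 2) * y.2 (localSharp g φ y.1 y.2) + U (φ.symm y.1) := by
  rw [localHamiltonian, hamiltonian, cometric_self]
  rfl

theorem contDiffOn_localHamiltonian (hφ : φ ∈ IsManifold.maximalAtlas (𝓡 n) ∞ Q)
    (hU : ContMDiff (𝓡 n) 𝓘(ℝ, ℝ) ∞ U) :
    ContDiffOn ℝ ∞ (localHamiltonian g U φ) (φ.target ×ˢ univ) := by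
  have hS : ContDiffOn ℝ ∞ (fun y : Model n × DualModel n => localSharp g φ y.1)
      (φ.target ×ˢ univ) :=
    (contDiffOn_localSharp hφ).comp contDiff_fst.contDiffOn fun y hy => hy.1
  have hV : ContDiffOn ℝ ∞ (fun y : Model n × DualModel n => U (φ.symm y.1))
      (φ.target ×ˢ univ) := by
    have h : ContDiffOn ℝ ∞ (fun z => U (φ.symm z)) φ.target :=
      (hU.comp_contMDiffOn (contMDiffOn_symm_of_mem_maximalAtlas hφ)).contDiffOn
    exact h.comp contDiff_fst.contDiffOn fun y hy => hy.1
  have hp : ContDiffOn ℝ ∞ (fun y : Model n × DualModel n => y.2) (φ.target ×ˢ univ) :=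
    contDiff_snd.contDiffOn
  refine (((contDiffOn_const (c := (1 / 2 : ℝ))).mul (hp.clm_apply (hS.clm_apply hp))).add hV).congr fun y _ => ?_
  exact localHamiltonian_eq y

theorem apply_localSharp_comm (z : Model n) (p p' : DualModel n) :
    p (localSharp g φ z p') = p' (localSharp g φ z p) :=
  apply_sharp_comm (g := g) (p.comp (chartDiff φ (φ.symm z))) (p'.comp (chartDiff φ (φ.symm z)))

/-- The symmetry of the cometric merges the two terms of the product rule and removes the factor
`1/2`. Thus `∂_p H` is `p` with its index raised. -/
theorem hasFDerivAt_localHamiltonian_snd (z : Model n) (p : DualModel n) :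
    HasFDerivAt (fun p => localHamiltonian g U φ (z, p))
      (ContinuousLinearMap.apply ℝ ℝ (localSharp g φ z p)) p := by
  simp only [localHamiltonian_eq]
  have h := ((((hasFDerivAt_id (𝕜 := ℝ) p).clm_apply
    (localSharp g φ z).hasFDerivAt).const_mul (1 / 2 : ℝ)).add_const (U (φ.symm z)))
  refine h.congr_fderiv ?_
  ext δ
  have := apply_localSharp_comm (g := g) (φ := φ) z p δ
  simp at this ⊢
  linarith

theorem fderiv_localHamiltonian_inr (hφ : φ ∈ IsManifold.maximalAtlas (𝓡 n) ∞ Q)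
    {y : Model n × DualModel n} (hU : ContMDiff (𝓡 n) 𝓘(ℝ, ℝ) ∞ U)
    (hy : y.1 ∈ φ.target) (δ : DualModel n) :
    fderiv ℝ (localHamiltonian g U φ) y (0, δ) = δ (localSharp g φ y.1 y.2) := by
  have h0 : HasFDerivAt (fun p => localHamiltonian g U φ (y.1, p)) _ y.2 :=
    HasFDerivAt.comp (g := localHamiltonian g U φ) y.2
      (((contDiffOn_localHamiltonian hφ hU).contDiffAt
        ((bundleChart φ hφ).open_target.mem_nhds (x := y) ⟨hy, mem_univ _⟩)).differentiableAt
          (by simp)).hasFDerivAt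
      (hasFDerivAt_prodMk_right y.1 y.2)
  exact DFunLike.congr_fun (h0.unique (hasFDerivAt_localHamiltonian_snd y.1 y.2)) δ

theorem partialP_eq (x : CotangentBundle n Q) :
    partialP φ (hamiltonian g U) x = localSharp g φ (bundleCoord φ x).1 (bundleCoord φ x).2 := by
  ext i
  have h := (hasFDerivAt_localHamiltonian_snd (g := g) (U := U) (φ := φ)
    (bundleCoord φ x).1 (bundleCoord φ x).2).fderiv
  exact DFunLike.congr_fun h (EuclideanSpace.proj i)

theorem partialQ_eq (hφ : φ ∈ IsManifold.maximalAtlas (𝓡 n) ∞ Q)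
    (hU : ContMDiff (𝓡 n) 𝓘(ℝ, ℝ) ∞ U) {x : CotangentBundle n Q} (hx : x.1 ∈ φ.source)
    (u : Model n) :
    partialQ φ (hamiltonian g U) x u =
      fderiv ℝ (localHamiltonian g U φ) (bundleCoord φ x) (u, 0) := by
  have hy : (bundleCoord φ x).1 ∈ φ.target := φ.map_source hx
  have h0 : HasFDerivAt (fun q => localHamiltonian g U φ (q, (bundleCoord φ x).2)) _
      (bundleCoord φ x).1 :=
    HasFDerivAt.comp (g := localHamiltonian g U φ) (bundleCoord φ x).1
      (((contDiffOn_localHamiltonian hφ hU).contDiffAt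
        ((bundleChart φ hφ).open_target.mem_nhds (x := bundleCoord φ x)
          ⟨hy, mem_univ _⟩)).differentiableAt (by simp)).hasFDerivAt
      (hasFDerivAt_prodMk_left (bundleCoord φ x).1 (bundleCoord φ x).2)
  exact DFunLike.congr_fun h0.fderiv u

theorem exists_eq_bundlePoint (hφ : φ ∈ IsManifold.maximalAtlas (𝓡 n) ∞ Q)
    {x : CotangentBundle n Q} (hx : x.1 ∈ φ.source) :
    ∃ y : Model n × DualModel n, y.1 ∈ φ.target ∧ x = bundlePoint φ y.1 y.2 :=
  ⟨bundleCoord φ x, φ.map_source hx, (bundlePoint_bundleCoord hφ hx).symm⟩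

theorem partialP_eq_chartDiff_sharp (hφ : φ ∈ IsManifold.maximalAtlas (𝓡 n) ∞ Q)
    {x : CotangentBundle n Q} (hx : x.1 ∈ φ.source) :
    partialP φ (hamiltonian g U) x = chartDiff φ x.1 (sharp g x.1 x.2) := by
  obtain ⟨y, hy, rfl⟩ := exists_eq_bundlePoint hφ hx
  rw [partialP_eq, bundleCoord_bundlePoint hφ hy]
  rfl

/-! ### The physical leaf in a bundle chart -/

/-- The differential of a chart is injective, so the condition in any one chart is the chart-free
one; `chartAt` provides a chart around the point, so the quantifier over charts is not vacuous. -/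
theorem mem_physicalLeaf_iff_coproj_sharp {x : CotangentBundle n Q} :
    x ∈ physicalLeaf g W (hamiltonian g U) ↔ coproj g W x.1 (sharp g x.1 x.2) = 0 := by
  have key : ∀ φ ∈ IsManifold.maximalAtlas (𝓡 n) ∞ Q, x.1 ∈ φ.source →
      (chartMatrix φ x.1 (coproj g W x.1) (partialP φ (hamiltonian g U) x) = 0 ↔
        coproj g W x.1 (sharp g x.1 x.2) = 0) := by
    intro φ hφ hx
    rw [partialP_eq_chartDiff_sharp hφ hx, chartMatrix, ContinuousLinearMap.comp_apply,
      ContinuousLinearMap.comp_apply, chartFrame_chartDiff hφ hx]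
    constructor
    · intro h
      rw [← chartFrame_chartDiff hφ hx (coproj g W x.1 _), h, map_zero]
    · intro h
      rw [h, map_zero]
  constructor
  · intro h
    have hφ := IsManifold.chart_mem_maximalAtlas (I := 𝓡 n) (n := ∞) x.1
    exact (key _ hφ (mem_chart_source _ _)).1 (h _ hφ (mem_chart_source _ _))
  · intro h φ hφ hx
    exact (key φ hφ hx).2 h

theorem mem_physicalLeaf_iff {x : CotangentBundle n Q} :
    x ∈ physicalLeaf g W (hamiltonian g U) ↔ x.2.comp (coproj g W x.1) = 0 := by
  rw [mem_physicalLeaf_iff_coproj_sharp, coproj_sharp_eq_zero_iff]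

theorem chartMatrix_proj_eq (hq : q ∈ φ.source) :
    chartMatrix φ q (proj g W q) = localProj g W φ (φ q) := by
  rw [localProj, φ.left_inv hq]

theorem localProj_localProj (hφ : φ ∈ IsManifold.maximalAtlas (𝓡 n) ∞ Q) {z : Model n}
    (hz : z ∈ φ.target) : (localProj g W φ z).comp (localProj g W φ z) = localProj g W φ z := by
  ext1 u
  change chartDiff φ _ (proj g W _ (chartFrame φ _ (chartDiff φ _ (proj g W _ _)))) =
    chartDiff φ _ (proj g W _ _)
  rw [chartFrame_chartDiff hφ (φ.map_target hz), proj_proj]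

theorem mem_physicalLeaf_iff_bundleCoord (hφ : φ ∈ IsManifold.maximalAtlas (𝓡 n) ∞ Q)
    {x : CotangentBundle n Q} (hx : x.1 ∈ φ.source) :
    x ∈ physicalLeaf g W (hamiltonian g U) ↔
      (bundleCoord φ x).2.comp (localProj g W φ (bundleCoord φ x).1) = (bundleCoord φ x).2 := by
  obtain ⟨y, hy, rfl⟩ := exists_eq_bundlePoint hφ hx
  rw [bundleCoord_bundlePoint hφ hy, mem_physicalLeaf_iff]
  constructor
  · intro h
    ext1 u
    have h1 := DFunLike.congr_fun h (chartFrame φ (φ.symm y.1) u)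
    change y.2 (chartDiff φ (φ.symm y.1)
      (chartFrame φ (φ.symm y.1) u - proj g W _ (chartFrame φ (φ.symm y.1) u))) = 0 at h1
    rw [map_sub, map_sub, chartDiff_chartFrame hφ (φ.map_target hy), sub_eq_zero] at h1
    exact h1.symm
  · intro h
    ext1 (v : TangentSpace (𝓡 n) (φ.symm y.1))
    have h1 := DFunLike.congr_fun h (chartDiff φ (φ.symm y.1) v)
    change y.2 (chartDiff φ _ (proj g W _ (chartFrame φ _ (chartDiff φ _ v)))) = _ at h1
    rw [chartFrame_chartDiff hφ (φ.map_target hy)] at h1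
    change y.2 (chartDiff φ (φ.symm y.1) (v - proj g W _ v)) = 0
    rw [map_sub, map_sub, h1, sub_self]

/-! ### The relations in a bundle chart -/

/-- The differential-algebraic relations at a point of the physical leaf, in the coordinates of a
bundle chart. -/
def LocalRelations (g : SmoothMetric n Q) (W : SmoothDistribution n k Q) (U : Q → ℝ)
    (φ : OpenPartialHomeomorph Q (Model n)) (y w : Model n × DualModel n) : Prop :=
  w.1 = localSharp g φ y.1 y.2 ∧ ∀ u, localProj g W φ y.1 u = u →
    w.2 u = -fderiv ℝ (localHamiltonian g U φ) y (u, 0)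

/-- On the leaf `∂_p H` already lies in `W`, so the projector drops out of the equation for `q̇`. -/
theorem chartMatrix_proj_partialP (hφ : φ ∈ IsManifold.maximalAtlas (𝓡 n) ∞ Q)
    {x : CotangentBundle n Q} (hx : x.1 ∈ φ.source)
    (hxl : x ∈ physicalLeaf g W (hamiltonian g U)) :
    chartMatrix φ x.1 (proj g W x.1) (partialP φ (hamiltonian g U) x) =
      localSharp g φ (bundleCoord φ x).1 (bundleCoord φ x).2 := by
  have h := mem_physicalLeaf_iff_coproj_sharp.1 hxl
  have h' : proj g W x.1 (sharp g x.1 x.2) = sharp g x.1 x.2 := (sub_eq_zero.1 h).symm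
  rw [← partialP_eq (U := U), partialP_eq_chartDiff_sharp hφ hx]
  simp only [chartMatrix, ContinuousLinearMap.comp_apply, chartFrame_chartDiff hφ hx, h']

theorem satisfiesRelations_iff (hU : ContMDiff (𝓡 n) 𝓘(ℝ, ℝ) ∞ U) {x : CotangentBundle n Q}
    (hxl : x ∈ physicalLeaf g W (hamiltonian g U)) (v : TangentSpace (cotangentModel n) x) :
    SatisfiesRelations g W (hamiltonian g U) x v ↔
      ∀ φ ∈ IsManifold.maximalAtlas (𝓡 n) ∞ Q, x.1 ∈ φ.source →
        LocalRelations g W U φ (bundleCoord φ x) (velocityCoord φ x v) := by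
  constructor
  · intro h φ hφ hx
    refine ⟨(h.qdot φ hφ hx).trans (chartMatrix_proj_partialP hφ hx hxl), fun u hu => ?_⟩
    have h1 := DFunLike.congr_fun (h.pdot φ hφ hx) u
    rw [chartMatrix_proj_eq hx] at h1
    change (velocityCoord φ x v).2 (localProj g W φ (φ x.1) u) =
      -(partialQ φ _ x (localProj g W φ (φ x.1) u)) at h1
    rw [← partialQ_eq hφ hU hx]
    rwa [show localProj g W φ (φ x.1) u = u from hu] at h1
  · intro h
    refine ⟨fun φ hφ hx => ?_, fun φ hφ hx => ?_, hxl⟩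
    · rw [chartMatrix_proj_partialP hφ hx hxl]
      exact (h φ hφ hx).1
    · ext1 u
      rw [chartMatrix_proj_eq hx]
      change (velocityCoord φ x v).2 (localProj g W φ (φ x.1) u) =
        -(partialQ φ _ x (localProj g W φ (φ x.1) u))
      rw [partialQ_eq hφ hU hx]
      exact (h φ hφ hx).2 _
        (DFunLike.congr_fun (localProj_localProj hφ (φ.map_source hx)) u)

/-- The d'Alembert form `ω(w, w') = dH(w')` over test vectors with base part in `W`. The vertical
tests `(0, δ)` recover `q̇`, the tests `(u, 0)` recover `ṗ` on `W`. Each ingredient has an invariant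
meaning, so this form passes between charts. -/
theorem localRelations_iff_symplectic (hφ : φ ∈ IsManifold.maximalAtlas (𝓡 n) ∞ Q)
    (hU : ContMDiff (𝓡 n) 𝓘(ℝ, ℝ) ∞ U) {y w : Model n × DualModel n} (hy : y.1 ∈ φ.target) :
    LocalRelations g W U φ y w ↔ ∀ w' : Model n × DualModel n, localProj g W φ y.1 w'.1 = w'.1 →
      w'.2 w.1 - w.2 w'.1 = fderiv ℝ (localHamiltonian g U φ) y w' := by
  have hsplit : ∀ w' : Model n × DualModel n, fderiv ℝ (localHamiltonian g U φ) y w' =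
      fderiv ℝ (localHamiltonian g U φ) y (w'.1, 0) + w'.2 (localSharp g φ y.1 y.2) := by
    intro w'
    rw [← fderiv_localHamiltonian_inr hφ hU hy, ← map_add]
    simp
  constructor
  · rintro ⟨h1, h2⟩ w' hw'
    rw [hsplit, h1, h2 _ hw']
    ring
  · intro h
    have h1 : w.1 = localSharp g φ y.1 y.2 := by
      ext i
      have := h (0, EuclideanSpace.proj i) (map_zero _)
      have h00 : fderiv ℝ (localHamiltonian g U φ) y ((0 : Model n), (0 : DualModel n)) = 0 :=
        map_zero _
      rw [hsplit] at this
      simpa [h00] using this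
    refine ⟨h1, fun u hu => ?_⟩
    have := h (u, 0) hu
    simp at this
    linarith

theorem fderiv_chartTransition (hφ : φ ∈ IsManifold.maximalAtlas (𝓡 n) ∞ Q)
    (hψ : ψ ∈ IsManifold.maximalAtlas (𝓡 n) ∞ Q) {z : Model n} (hz : z ∈ φ.target)
    (hz' : φ.symm z ∈ ψ.source) :
    fderiv ℝ (ψ ∘ φ.symm) z = (chartDiff ψ (φ.symm z)).comp (chartFrame φ (φ.symm z)) := by
  rw [← mfderiv_eq_fderiv, mfderiv_comp z ((chart_mdifferentiable hψ).mdifferentiableAt hz')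
    ((chart_mdifferentiable hφ).mdifferentiableAt_symm hz),
    chartFrame_eq_mfderiv_symm hφ (φ.map_target hz), φ.right_inv hz]
  rfl

theorem contDiffAt_chartTransition (hφ : φ ∈ IsManifold.maximalAtlas (𝓡 n) ∞ Q)
    (hψ : ψ ∈ IsManifold.maximalAtlas (𝓡 n) ∞ Q) {z : Model n} (hz : z ∈ φ.target)
    (hz' : φ.symm z ∈ ψ.source) : ContDiffAt ℝ ∞ (ψ ∘ φ.symm) z := by
  rw [← contMDiffAt_iff_contDiffAt]
  exact (contMDiffAt_of_mem_maximalAtlas hψ hz').comp z (contMDiffAt_symm_of_mem_maximalAtlas hφ hz)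

theorem eventually_bundleTransition {y : Model n × DualModel n}
    (hy : y.1 ∈ φ.target) (hy' : φ.symm y.1 ∈ ψ.source) :
    ∀ᶠ z in 𝓝 y, z.1 ∈ φ.target ∧ φ.symm z.1 ∈ ψ.source := by
  have h := (φ.isOpen_inter_preimage_symm ψ.open_source).preimage
    (continuous_fst (X := Model n) (Y := DualModel n))
  exact h.mem_nhds (x := y) ⟨hy, hy'⟩

theorem LocalRelations.change_chart (hφ : φ ∈ IsManifold.maximalAtlas (𝓡 n) ∞ Q)
    (hψ : ψ ∈ IsManifold.maximalAtlas (𝓡 n) ∞ Q) (hU : ContMDiff (𝓡 n) 𝓘(ℝ, ℝ) ∞ U)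
    {x : CotangentBundle n Q} (hx : x.1 ∈ φ.source) (hx' : x.1 ∈ ψ.source)
    {v : TangentSpace (cotangentModel n) x}
    (h : LocalRelations g W U φ (bundleCoord φ x) (velocityCoord φ x v)) :
    LocalRelations g W U ψ (bundleCoord ψ x) (velocityCoord ψ x v) := by
  have hy : (bundleCoord φ x).1 ∈ φ.target := φ.map_source hx
  have hq : φ.symm (bundleCoord φ x).1 = x.1 := φ.left_inv hx
  have hy' : φ.symm (bundleCoord φ x).1 ∈ ψ.source := hq.symm ▸ hx'
  have hev := eventually_bundleTransition hy hy'
  have hF := (contDiffAt_bundleTransition hφ hψ hy hy').differentiableAt (by simp)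
  have hf := (contDiffAt_chartTransition hφ hψ hy hy').of_le (m := 2) (WithTop.coe_le_coe.2 le_top)
  have h1 : ∀ᶠ z in 𝓝 (bundleCoord φ x), (bundleTransition φ ψ z).1 = (ψ ∘ φ.symm) z.1 :=
    .of_forall fun z => rfl
  have h2 : ∀ᶠ z in 𝓝 (bundleCoord φ x),
      (bundleTransition φ ψ z).2.comp (fderiv ℝ (ψ ∘ φ.symm) z.1) = z.2 := by
    filter_upwards [hev] with z hz
    rw [fderiv_chartTransition hφ hψ hz.1 hz.2]
    ext1 u
    change z.2 (chartDiff φ _ (chartFrame ψ _ (chartDiff ψ (φ.symm z.1) (chartFrame φ _ u)))) = _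
    rw [chartFrame_chartDiff hψ hz.2, chartDiff_chartFrame hφ (φ.map_target hz.1)]
  have hcoord : bundleTransition φ ψ (bundleCoord φ x) = bundleCoord ψ x := by
    rw [bundleTransition, bundlePoint_bundleCoord hφ hx]
  rw [localRelations_iff_symplectic hψ hU (ψ.map_source hx')]
  rw [localRelations_iff_symplectic hφ hU hy] at h
  intro w' hw'
  -- Each test vector in the chart `ψ` comes from a tangent vector `u`, whose coordinates in `φ`
  -- serve as the test vector there.
  obtain ⟨u, rfl⟩ := (velocityCoord_bijective hψ hx').2 w'
  have hvel := velocityCoord_eq_fderiv_bundleTransition hφ hψ hx hx'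
  have hproj : localProj g W φ (bundleCoord φ x).1 (velocityCoord φ x u).1 =
      (velocityCoord φ x u).1 := by
    rw [hvel, fderiv_fst_of_eventually (hf.differentiableAt (by simp)) hF h1,
      fderiv_chartTransition hφ hψ hy hy', hq] at hw'
    have hw'' := congrArg (fun a => chartDiff φ x.1 (chartFrame ψ x.1 a)) hw'
    have e1 : localProj g W ψ (bundleCoord ψ x).1 = chartMatrix ψ x.1 (proj g W x.1) :=
      (chartMatrix_proj_eq hx').symm
    have e2 : localProj g W φ (bundleCoord φ x).1 = chartMatrix φ x.1 (proj g W x.1) :=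
      (chartMatrix_proj_eq hx).symm
    rw [e1] at hw''
    rw [e2]
    simpa only [chartMatrix, ContinuousLinearMap.comp_apply, chartFrame_chartDiff hψ hx',
      chartDiff_chartFrame hφ hx] using hw''
  have hH : fderiv ℝ (localHamiltonian g U φ) (bundleCoord φ x) =
      (fderiv ℝ (localHamiltonian g U ψ) (bundleCoord ψ x)).comp
        (fderiv ℝ (bundleTransition φ ψ) (bundleCoord φ x)) := by
    have he : localHamiltonian g U φ =ᶠ[𝓝 (bundleCoord φ x)]
        localHamiltonian g U ψ ∘ bundleTransition φ ψ := by
      filter_upwards [hev] with z hz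
      simp only [localHamiltonian, Function.comp, bundleTransition]
      rw [bundlePoint_bundleCoord hψ hz.2]
    rw [he.fderiv_eq, fderiv_comp, hcoord]
    · rw [hcoord]
      exact ((contDiffOn_localHamiltonian hψ hU).contDiffAt
        ((bundleChart ψ hψ).open_target.mem_nhds (x := bundleCoord ψ x)
          ⟨ψ.map_source hx', mem_univ _⟩)).differentiableAt (by simp)
    · exact hF
  have := h _ hproj
  rw [hH, ← symplectic_fderiv hf hF h1 h2, ContinuousLinearMap.comp_apply, ← hvel, ← hvel] at this
  exact this

/-! ### The vector field in a bundle chart -/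

/-- The vector field determined by the relations, in the coordinates of a bundle chart. -/
def localField (g : SmoothMetric n Q) (W : SmoothDistribution n k Q) (U : Q → ℝ)
    (φ : OpenPartialHomeomorph Q (Model n)) (y : Model n × DualModel n) : Model n × DualModel n :=
  (localProj g W φ y.1 (localSharp g φ y.1 y.2),
    y.2.comp (fderiv ℝ (localProj g W φ) y.1 (localProj g W φ y.1 (localSharp g φ y.1 y.2))) -
      ((fderiv ℝ (localHamiltonian g U φ) y).comp
        (ContinuousLinearMap.inl ℝ (Model n) (DualModel n))).comp (localProj g W φ y.1))

theorem contDiffOn_localField (hφ : φ ∈ IsManifold.maximalAtlas (𝓡 n) ∞ Q)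
    (hU : ContMDiff (𝓡 n) 𝓘(ℝ, ℝ) ∞ U) :
    ContDiffOn ℝ ∞ (localField g W U φ) (φ.target ×ˢ univ) := by
  have hfst : MapsTo (Prod.fst : Model n × DualModel n → Model n) (φ.target ×ˢ univ) φ.target :=
    fun y hy => hy.1
  have hS := (contDiffOn_localSharp (g := g) hφ).comp contDiff_fst.contDiffOn hfst
  have hP := (contDiffOn_localProj (g := g) (W := W) hφ).comp contDiff_fst.contDiffOn hfst
  have hDP := ((contDiffOn_localProj (g := g) (W := W) hφ).fderiv_of_isOpen (m := ∞)
    φ.open_target (by simp)).comp contDiff_fst.contDiffOn hfst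
  have hH := (contDiffOn_localHamiltonian (g := g) hφ hU).fderiv_of_isOpen (m := ∞)
    (bundleChart φ hφ).open_target (by simp)
  have hp : ContDiffOn ℝ ∞ (Prod.snd : Model n × DualModel n → _) (φ.target ×ˢ univ) :=
    contDiff_snd.contDiffOn
  have h1 := hP.clm_apply (hS.clm_apply hp)
  exact h1.prodMk ((hp.clm_comp (hDP.clm_apply h1)).sub
    ((hH.clm_comp contDiffOn_const).clm_comp hP))

/-! ### The velocity at a point of the leaf: existence and uniqueness -/

theorem localProj_localSharp (hφ : φ ∈ IsManifold.maximalAtlas (𝓡 n) ∞ Q)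
    {y : Model n × DualModel n} (hy : y.1 ∈ φ.target) (hyl : y.2.comp (localProj g W φ y.1) = y.2) :
    localProj g W φ y.1 (localSharp g φ y.1 y.2) = localSharp g φ y.1 y.2 := by
  have hx : (bundlePoint φ y.1 y.2 : CotangentBundle n Q).1 ∈ φ.source := φ.map_target hy
  have hb := bundleCoord_bundlePoint hφ hy
  -- The claim does not involve the potential, so it may be taken to be zero.
  have h := chartMatrix_proj_partialP (g := g) (W := W) (U := 0) hφ hx
    ((mem_physicalLeaf_iff_bundleCoord hφ hx).2 (by rw [hb, hyl]))
  rw [partialP_eq, hb] at h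
  exact h

/-- The derivative of `P ∘ P = P`. Evaluated on the range of `P` it gives `P ∘ DP(a) ∘ P = 0`, which
is how it is used. -/
theorem fderiv_localProj_comp (hφ : φ ∈ IsManifold.maximalAtlas (𝓡 n) ∞ Q) {z : Model n}
    (hz : z ∈ φ.target) (a u : Model n) :
    localProj g W φ z (fderiv ℝ (localProj g W φ) z a u) +
      fderiv ℝ (localProj g W φ) z a (localProj g W φ z u) =
      fderiv ℝ (localProj g W φ) z a u := by
  have hd := (((contDiffOn_localProj (g := g) (W := W) hφ).contDiffAt
    (φ.open_target.mem_nhds hz)).differentiableAt (by simp)).hasFDerivAt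
  have h1 := hd.clm_comp hd
  have he : (fun z => (localProj g W φ z).comp (localProj g W φ z)) =ᶠ[𝓝 z] localProj g W φ := by
    filter_upwards [φ.open_target.mem_nhds hz] with z' hz' using localProj_localProj hφ hz'
  have := (h1.congr_of_eventuallyEq he.symm).unique hd
  exact DFunLike.congr_fun (DFunLike.congr_fun this a) u

/-- The term `p ∘ DP(q̇)`, added for tangency, vanishes on `W`: there `P ∘ DP(q̇) = 0`, and `p = p ∘
P`. -/
theorem localRelations_localField (hφ : φ ∈ IsManifold.maximalAtlas (𝓡 n) ∞ Q)
    {y : Model n × DualModel n} (hy : y.1 ∈ φ.target) (hyl : y.2.comp (localProj g W φ y.1) = y.2) :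
    LocalRelations g W U φ y (localField g W U φ y) := by
  refine ⟨localProj_localSharp hφ hy hyl, fun u hu => ?_⟩
  set a := localProj g W φ y.1 (localSharp g φ y.1 y.2) with ha
  have h0 : localProj g W φ y.1 (fderiv ℝ (localProj g W φ) y.1 a u) = 0 := by
    have := fderiv_localProj_comp (g := g) (W := W) hφ hy a u
    rwa [hu, add_eq_right] at this
  have h1 : y.2 (fderiv ℝ (localProj g W φ) y.1 a u) = 0 := by
    rw [← hyl, ContinuousLinearMap.comp_apply, h0, map_zero]
  change y.2 (fderiv ℝ (localProj g W φ) y.1 a u) -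
    fderiv ℝ (localHamiltonian g U φ) y (localProj g W φ y.1 u, 0) = _
  rw [h1, hu, zero_sub]

/-- `ht` is the derivative of the constraint `p ∘ P = p`. It expresses `ṗ` through `q̇` and `ṗ ∘ P`,
both of which are prescribed by the relations. -/
theorem eq_localField (hφ : φ ∈ IsManifold.maximalAtlas (𝓡 n) ∞ Q)
    {y w : Model n × DualModel n} (hy : y.1 ∈ φ.target)
    (hyl : y.2.comp (localProj g W φ y.1) = y.2) (hw : LocalRelations g W U φ y w)
    (ht : y.2.comp (fderiv ℝ (localProj g W φ) y.1 w.1) + w.2.comp (localProj g W φ y.1) = w.2) :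
    w = localField g W U φ y := by
  have h1 : w.1 = (localField g W U φ y).1 := hw.1.trans (localProj_localSharp hφ hy hyl).symm
  refine Prod.ext h1 ?_
  ext1 u
  have h2 : w.2 (localProj g W φ y.1 u) = _ :=
    hw.2 _ (DFunLike.congr_fun (localProj_localProj hφ hy) u)
  rw [← ht, h1]
  change y.2 (fderiv ℝ (localProj g W φ) y.1 _ u) + w.2 (localProj g W φ y.1 u) =
    y.2 (fderiv ℝ (localProj g W φ) y.1 _ u) -
      fderiv ℝ (localHamiltonian g U φ) y (localProj g W φ y.1 u, 0)
  rw [h2, sub_eq_add_neg]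
  rfl

/-! ### The constraint along curves and its invariance under the local field -/

theorem tangency_of_hasDerivWithinAt (hφ : φ ∈ IsManifold.maximalAtlas (𝓡 n) ∞ Q)
    {c : ℝ → Model n × DualModel n} {w : Model n × DualModel n} {J : Set ℝ} {t : ℝ}
    (hc : HasDerivWithinAt c w J t) (hJ : UniqueDiffWithinAt ℝ J t) (ht : t ∈ J)
    (hy : (c t).1 ∈ φ.target)
    (hcl : ∀ᶠ s in 𝓝[J] t, (c s).2.comp (localProj g W φ (c s).1) = (c s).2) :
    (c t).2.comp (fderiv ℝ (localProj g W φ) (c t).1 w.1) +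
      w.2.comp (localProj g W φ (c t).1) = w.2 := by
  have hd := (((contDiffOn_localProj (g := g) (W := W) hφ).contDiffAt
    (φ.open_target.mem_nhds hy)).differentiableAt (by simp)).hasFDerivAt
  have h1 : HasDerivWithinAt (fun s => (c s).1) w.1 J t := hc.fst
  have h2 : HasDerivWithinAt (fun s => (c s).2) w.2 J t := hc.snd
  have h3 := h2.clm_comp (hd.comp_hasDerivWithinAt t h1)
  have h4 := (h3.congr_of_eventuallyEq (hcl.mono fun s hs => hs.symm)
    (hcl.self_of_nhdsWithin ht).symm)
  have := hJ.eq_deriv _ h4 h2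
  exact (add_comm _ _).trans this

theorem eq_zero_of_hasDerivAt_neg_comp {E : Type*} [NormedAddCommGroup E] [NormedSpace ℝ E]
    {L : ℝ → E →L[ℝ] E} {c : ℝ → E →L[ℝ] ℝ} {ε : ℝ} (hL : ContinuousOn L (Ioo (-ε) ε))
    (hc : ∀ s ∈ Ioo (-ε) ε, HasDerivAt c (-(c s).comp (L s)) s) (h0 : c 0 = 0) :
    ∀ t ∈ Ioo (-ε) ε, c t = 0 := by
  intro t ht
  -- `L` need not be bounded on the open interval; on the compact interval `[-r, r]`, with `|t| < r
  -- < ε`, a bound exists and serves as a Lipschitz constant.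
  obtain ⟨r, hr, hrε⟩ := exists_between (abs_lt.2 ⟨by linarith [ht.1], ht.2⟩)
  have hsub : Icc (-r) r ⊆ Ioo (-ε) ε := fun s hs => ⟨by linarith [hs.1], by linarith [hs.2]⟩
  obtain ⟨K, hK⟩ := isCompact_Icc.exists_bound_of_continuousOn (hL.mono hsub)
  have hr0 : 0 < r := (abs_nonneg t).trans_lt hr
  have huniq : EqOn c (fun _ => 0) (Ioo (-r) r) :=
    ODE_solution_unique_of_mem_Ioo (v := fun s x => -(x.comp (L s)))
      (s := fun _ => univ) (K := K.toNNReal) (t₀ := 0)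
      (fun s hs => LipschitzOnWith.of_dist_le_mul fun x _ y _ => by
        rw [dist_neg_neg, dist_eq_norm, dist_eq_norm, ← ContinuousLinearMap.sub_comp, mul_comm]
        refine (ContinuousLinearMap.opNorm_comp_le _ _).trans ?_
        gcongr
        exact (hK s (Ioo_subset_Icc_self hs)).trans (Real.le_coe_toNNReal K))
      ⟨by linarith, hr0⟩
      (fun s hs => ⟨hc s (hsub (Ioo_subset_Icc_self hs)), mem_univ _⟩)
      (fun s _ => ⟨by simpa using hasDerivAt_const s (0 : E →L[ℝ] ℝ), mem_univ _⟩) h0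
  exact huniq (abs_lt.1 hr)

/-- The curve is not assumed to lie on the leaf. In the derivative of `c = p - p ∘ P` the `∂_q H`
terms cancel and `-p ∘ DP(q̇) ∘ P` remains; since `P ∘ DP(q̇) ∘ P = 0`, here `p` may be replaced by
`c`. The equation is thus linear and homogeneous in `c`. -/
theorem hasDerivAt_sub_comp_localProj (hφ : φ ∈ IsManifold.maximalAtlas (𝓡 n) ∞ Q)
    {α : ℝ → Model n × DualModel n} {s : ℝ} (hα : HasDerivAt α (localField g W U φ (α s)) s)
    (hy : (α s).1 ∈ φ.target) :
    HasDerivAt (fun s => (α s).2 - (α s).2.comp (localProj g W φ (α s).1))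
      (-((α s).2 - (α s).2.comp (localProj g W φ (α s).1)).comp
        ((fderiv ℝ (localProj g W φ) (α s).1 (localField g W U φ (α s)).1).comp
          (localProj g W φ (α s).1))) s := by
  have hd := (((contDiffOn_localProj (g := g) (W := W) hφ).contDiffAt (φ.open_target.mem_nhds hy)).differentiableAt
    (by simp)).hasFDerivAt
  have h1 : HasDerivAt (fun s => (α s).1) _ s := hα.fst
  have h2 : HasDerivAt (fun s => (α s).2) _ s := hα.snd
  have h3 := h2.sub (h2.clm_comp (hd.comp_hasDerivAt s h1))
  refine h3.congr_deriv ?_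
  ext1 u
  have e1 := fderiv_localProj_comp (g := g) (W := W) hφ hy (localField g W U φ (α s)).1 u
  have e2 := fderiv_localProj_comp (g := g) (W := W) hφ hy (localField g W U φ (α s)).1
    (localProj g W φ (α s).1 u)
  have e3 : localProj g W φ (α s).1 (localProj g W φ (α s).1 u) = localProj g W φ (α s).1 u :=
    DFunLike.congr_fun (localProj_localProj hφ hy) u
  rw [e3, add_eq_right] at e2
  have e4 := congrArg (α s).2 e2
  rw [map_zero] at e4
  set D := fderiv ℝ (localProj g W φ) (α s).1 with hD
  set a := (localField g W U φ (α s)).1 with ha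
  have hw2 : ∀ u, (localField g W U φ (α s)).2 u = (α s).2 (D a u) -
      fderiv ℝ (localHamiltonian g U φ) (α s) (localProj g W φ (α s).1 u, 0) := fun u => rfl
  change (localField g W U φ (α s)).2 u - ((localField g W U φ (α s)).2
    (localProj g W φ (α s).1 u) + (α s).2 (D a u)) =
    -((α s).2 (D a (localProj g W φ (α s).1 u)) -
      (α s).2 (localProj g W φ (α s).1 (D a (localProj g W φ (α s).1 u))))
  rw [hw2, hw2, e3, e4]
  ring

theorem comp_localProj_eq_of_hasDerivAt (hφ : φ ∈ IsManifold.maximalAtlas (𝓡 n) ∞ Q)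
    (hU : ContMDiff (𝓡 n) 𝓘(ℝ, ℝ) ∞ U) {α : ℝ → Model n × DualModel n} {ε : ℝ}
    (hα : ∀ t ∈ Ioo (-ε) ε, HasDerivAt α (localField g W U φ (α t)) t ∧ (α t).1 ∈ φ.target)
    (h0 : (α 0).2.comp (localProj g W φ (α 0).1) = (α 0).2) :
    ∀ t ∈ Ioo (-ε) ε, (α t).2.comp (localProj g W φ (α t).1) = (α t).2 := by
  have hP := contDiffOn_localProj (g := g) (W := W) hφ
  have hDP := hP.fderiv_of_isOpen (m := ∞) φ.open_target (by simp)
  have hmaps : MapsTo (fun s => (α s).1) (Ioo (-ε) ε) φ.target := fun s hs => (hα s hs).2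
  have hαc : ContinuousOn α (Ioo (-ε) ε) := fun s hs =>
    (hα s hs).1.continuousAt.continuousWithinAt
  have hL : ContinuousOn (fun s =>
      (fderiv ℝ (localProj g W φ) (α s).1 (localField g W U φ (α s)).1).comp
        (localProj g W φ (α s).1)) (Ioo (-ε) ε) :=
    ((hDP.continuousOn.comp hαc.fst hmaps).clm_apply
      ((contDiffOn_localField hφ hU).continuousOn.comp hαc
        fun s hs => ⟨hmaps hs, mem_univ _⟩).fst).clm_comp (hP.continuousOn.comp hαc.fst hmaps)
  intro t ht
  exact (sub_eq_zero.1 (eq_zero_of_hasDerivAt_neg_comp hL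
    (fun s hs => hasDerivAt_sub_comp_localProj hφ (hα s hs).1 (hα s hs).2)
    (sub_eq_zero.2 h0.symm) t ht)).symm

/-! ### Local flows of smooth vector fields on open subsets of a Banach space -/

theorem contDiffOn_Ioo_of_hasDerivAt {E : Type*} [NormedAddCommGroup E] [NormedSpace ℝ E]
    [CompleteSpace E] {f : E → E} {u : Set E} (hf : ContDiffOn ℝ ∞ f u) {α : ℝ → E} {a b : ℝ}
    (hα : ∀ t ∈ Ioo a b, HasDerivAt α (f (α t)) t ∧ α t ∈ u) : ContDiffOn ℝ ∞ α (Ioo a b) := by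
  intro t ht
  obtain ⟨a', ha, ha'⟩ := exists_between ht.1
  obtain ⟨b', hb, hb'⟩ := exists_between ht.2
  have hsub : Icc a' b' ⊆ Ioo a b := fun s hs => ⟨ha.trans_le hs.1, hs.2.trans_lt hb'⟩
  have := ODE.contDiffOn_enat_Icc_of_hasDerivWithinAt (f := fun _ => f) (u := u) (n := ⊤)
    (tmin := a') (tmax := b') (α := α)
    (hf.comp contDiff_snd.contDiffOn fun y hy => hy.2)
    (fun s hs => (hα s (hsub hs)).1.hasDerivWithinAt) fun s hs => (hα s (hsub hs)).2
  exact ((this t ⟨ha'.le, hb.le⟩).contDiffAt (Icc_mem_nhds ha' hb)).contDiffWithinAt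

/-- The time `ε` serves all initial points near `x₀`. Joint continuity of the Picard–Lindelöf flow
at `(x₀, 0)` also keeps the solutions inside `u`, after the ball and the time are shrunk. -/
theorem exists_local_flow {E : Type*} [NormedAddCommGroup E] [NormedSpace ℝ E]
    [CompleteSpace E] {f : E → E} {u : Set E} (hu : IsOpen u) (hf : ContDiffOn ℝ ∞ f u) {x₀ : E}
    (hx₀ : x₀ ∈ u) :
    ∃ r > (0 : ℝ), ∃ ε > (0 : ℝ), ∀ x ∈ Metric.closedBall x₀ r, ∃ α : ℝ → E, α 0 = x ∧
      ∀ t ∈ Ioo (-ε) ε, HasDerivAt α (f (α t)) t ∧ α t ∈ u := by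
  have hf1 : ContDiffAt ℝ 1 f x₀ :=
    (hf.contDiffAt (hu.mem_nhds hx₀)).of_le (WithTop.coe_le_coe.2 le_top)
  obtain ⟨ε, hε, a, r, L, K, hr, hpl⟩ := IsPicardLindelof.of_contDiffAt_one hf1
  obtain ⟨α, hα, hαc⟩ := (hpl 0).exists_forall_mem_closedBall_eq_hasDerivWithinAt_continuousOn
  have hr' : (0 : ℝ) < r := hr
  have hnhds : Metric.closedBall x₀ r ×ˢ Icc (0 - ε) (0 + ε) ∈ 𝓝 (x₀, (0 : ℝ)) :=
    prod_mem_nhds (Metric.closedBall_mem_nhds x₀ hr') (Icc_mem_nhds (by linarith) (by linarith))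
  have hα0 : α (x₀, 0) = x₀ := (hα x₀ (Metric.mem_closedBall_self hr'.le)).1
  have hmem : α ⁻¹' u ∈ 𝓝 (x₀, (0 : ℝ)) :=
    (hαc.continuousAt hnhds).preimage_mem_nhds (hα0.symm ▸ hu.mem_nhds hx₀)
  obtain ⟨δ, hδ, hball⟩ := Metric.mem_nhds_iff.1 (inter_mem hmem hnhds)
  have hball' : ∀ x ∈ Metric.closedBall x₀ (δ / 2), ∀ t ∈ Ioo (-δ) δ,
      (x, t) ∈ α ⁻¹' u ∩ Metric.closedBall x₀ r ×ˢ Icc (0 - ε) (0 + ε) := by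
    intro x hx t ht
    refine hball ?_
    rw [Metric.mem_ball, Prod.dist_eq, max_lt_iff]
    refine ⟨(Metric.mem_closedBall.1 hx).trans_lt (by linarith), ?_⟩
    rw [Real.dist_eq, sub_zero]
    exact abs_lt.2 ht
  refine ⟨δ / 2, by linarith, min δ ε, lt_min hδ hε, fun x hx => ⟨fun t => α (x, t), ?_, ?_⟩⟩
  · exact (hα x (hball' x hx 0 ⟨by linarith, hδ⟩).2.1).1
  · intro t ht
    have h1 := hball' x hx t ⟨by linarith [ht.1, min_le_left δ ε],
      ht.2.trans_le (min_le_left δ ε)⟩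
    refine ⟨((hα x h1.2.1).2 t h1.2.2).hasDerivAt ?_, h1.1⟩
    exact Icc_mem_nhds (by linarith [ht.1, min_le_right δ ε]) (by linarith [ht.2, min_le_right δ ε])

/-! ### Orbits in bundle charts -/

theorem hasDerivWithinAt_bundleCoord (hφ : φ ∈ IsManifold.maximalAtlas (𝓡 n) ∞ Q)
    {γ : ℝ → CotangentBundle n Q} {J : Set ℝ} {t : ℝ}
    (hγ : MDifferentiableWithinAt 𝓘(ℝ, ℝ) (cotangentModel n) γ J t) (ht : (γ t).1 ∈ φ.source) :
    HasDerivWithinAt (fun s => bundleCoord φ (γ s))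
      (velocityCoord φ (γ t) (mfderivWithin 𝓘(ℝ, ℝ) (cotangentModel n) γ J t (1 : ℝ))) J t := by
  have h1 := ((bundleChart_mdifferentiable hφ).mdifferentiableAt
    (x := γ t) ht).hasMFDerivAt.comp_hasMFDerivWithinAt t hγ.hasMFDerivWithinAt
  have h2 : HasFDerivWithinAt (𝕜 := ℝ) (E := ℝ) (F := Model n × DualModel n)
      (fun s => bundleCoord φ (γ s)) _ J t := hasMFDerivWithinAt_iff_hasFDerivWithinAt.1 h1
  exact h2.hasDerivWithinAt

/-- Tangent vectors at points that are only propositionally equal are compared in the common model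
space. -/
theorem SatisfiesRelations.congr {H : CotangentBundle n Q → ℝ} {x x' : CotangentBundle n Q}
    {v : TangentSpace (cotangentModel n) x} {v' : TangentSpace (cotangentModel n) x'}
    (h : SatisfiesRelations g W H x v) (hx : x' = x)
    (hv : @Eq (Model n × DualModel n) v' v) : SatisfiesRelations g W H x' v' := by
  subst hx
  have hv' : v' = v := hv
  rwa [hv']

/-- `J` may be one-sided at `t`: unique differentiability is enough to differentiate the constraint.
The lemma therefore covers both the initial time of an orbit and the curves that define tangent
vectors. -/
theorem localRelations_eq_localField (hU : ContMDiff (𝓡 n) 𝓘(ℝ, ℝ) ∞ U)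
    (hφ : φ ∈ IsManifold.maximalAtlas (𝓡 n) ∞ Q) {γ : ℝ → CotangentBundle n Q} {J : Set ℝ} {t : ℝ}
    (hγ : MDifferentiableWithinAt 𝓘(ℝ, ℝ) (cotangentModel n) γ J t)
    (hJ : UniqueDiffWithinAt ℝ J t) (htJ : t ∈ J)
    (hl : ∀ᶠ s in 𝓝[J] t, γ s ∈ physicalLeaf g W (hamiltonian g U))
    (hr : SatisfiesRelations g W (hamiltonian g U) (γ t)
      (mfderivWithin 𝓘(ℝ, ℝ) (cotangentModel n) γ J t (1 : ℝ))) (ht : (γ t).1 ∈ φ.source) :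
    velocityCoord φ (γ t) (mfderivWithin 𝓘(ℝ, ℝ) (cotangentModel n) γ J t (1 : ℝ)) =
      localField g W U φ (bundleCoord φ (γ t)) := by
  have hlt := hl.self_of_nhdsWithin htJ
  have hsrc : ∀ᶠ s in 𝓝[J] t, (γ s).1 ∈ φ.source :=
    hγ.continuousWithinAt ((bundleChart φ hφ).open_source.mem_nhds (x := γ t) ht)
  refine eq_localField hφ (φ.map_source ht) ((mem_physicalLeaf_iff_bundleCoord hφ ht).1 hlt)
    ((satisfiesRelations_iff hU hlt _).1 hr φ hφ ht) ?_
  refine tangency_of_hasDerivWithinAt hφ (hasDerivWithinAt_bundleCoord hφ hγ ht) hJ htJ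
    (φ.map_source ht) ?_
  filter_upwards [hl, hsrc] with s hs hs'
  exact (mem_physicalLeaf_iff_bundleCoord hφ hs').1 hs

theorem IsPhysicalOrbit.hasDerivWithinAt (hU : ContMDiff (𝓡 n) 𝓘(ℝ, ℝ) ∞ U)
    (hφ : φ ∈ IsManifold.maximalAtlas (𝓡 n) ∞ Q) {γ : ℝ → CotangentBundle n Q} {J : Set ℝ} {t : ℝ}
    (hγ : IsPhysicalOrbit g W (hamiltonian g U) J γ) (hJ : UniqueDiffWithinAt ℝ J t) (htJ : t ∈ J)
    (ht : (γ t).1 ∈ φ.source) :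
    HasDerivWithinAt (fun s => bundleCoord φ (γ s))
      (localField g W U φ (bundleCoord φ (γ t))) J t := by
  have hd := (hγ.smooth t htJ).mdifferentiableWithinAt (by simp)
  rw [← localRelations_eq_localField hU hφ hd hJ htJ
    (eventually_mem_nhdsWithin.mono hγ.mem_leaf) (hγ.relations t htJ) ht]
  exact hasDerivWithinAt_bundleCoord hφ hd ht

theorem satisfiesRelations_of_velocityCoord (hU : ContMDiff (𝓡 n) 𝓘(ℝ, ℝ) ∞ U)
    (hφ : φ ∈ IsManifold.maximalAtlas (𝓡 n) ∞ Q) {x : CotangentBundle n Q} (hx : x.1 ∈ φ.source)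
    (hxl : x ∈ physicalLeaf g W (hamiltonian g U)) {v : TangentSpace (cotangentModel n) x}
    (hv : velocityCoord φ x v = localField g W U φ (bundleCoord φ x)) :
    SatisfiesRelations g W (hamiltonian g U) x v := by
  refine (satisfiesRelations_iff hU hxl v).2 fun ψ hψ hx' =>
    LocalRelations.change_chart hφ hψ hU hx hx' ?_
  rw [hv]
  exact localRelations_localField hφ (φ.map_source hx)
    ((mem_physicalLeaf_iff_bundleCoord hφ hx).1 hxl)

theorem isPhysicalOrbit_bundlePoint (hU : ContMDiff (𝓡 n) 𝓘(ℝ, ℝ) ∞ U)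
    (hφ : φ ∈ IsManifold.maximalAtlas (𝓡 n) ∞ Q) {α : ℝ → Model n × DualModel n} {a b : ℝ}
    (hα : ∀ t ∈ Ioo a b, HasDerivAt α (localField g W U φ (α t)) t ∧ (α t).1 ∈ φ.target)
    (hl : ∀ t ∈ Ioo a b, (α t).2.comp (localProj g W φ (α t).1) = (α t).2) :
    IsPhysicalOrbit g W (hamiltonian g U) (Ioo a b)
      (fun t => bundlePoint φ (α t).1 (α t).2) := by
  have hs : ContDiffOn ℝ ∞ α (Ioo a b) := contDiffOn_Ioo_of_hasDerivAt
    (contDiffOn_localField hφ hU) fun t ht => ⟨(hα t ht).1, (hα t ht).2, mem_univ _⟩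
  have hsm : ContMDiffOn 𝓘(ℝ, ℝ) (cotangentModel n) ∞
      (fun t => (bundlePoint φ (α t).1 (α t).2 : CotangentBundle n Q)) (Ioo a b) :=
    (contMDiffOn_bundlePoint hφ).comp hs.contMDiffOn fun t ht => ⟨(hα t ht).2, mem_univ _⟩
  have hsrc : ∀ t ∈ Ioo a b, (bundlePoint φ (α t).1 (α t).2 : CotangentBundle n Q).1 ∈ φ.source :=
    fun t ht => φ.map_target (hα t ht).2
  have hleaf : ∀ t ∈ Ioo a b, (bundlePoint φ (α t).1 (α t).2 : CotangentBundle n Q) ∈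
      physicalLeaf g W (hamiltonian g U) := fun t ht =>
    (mem_physicalLeaf_iff_bundleCoord hφ (hsrc t ht)).2 (by
      rw [bundleCoord_bundlePoint hφ (hα t ht).2, hl t ht])
  refine ⟨hsm, hleaf, fun t ht => ?_⟩
  refine satisfiesRelations_of_velocityCoord hU hφ (hsrc t ht) (hleaf t ht) ?_
  have h1 := hasDerivWithinAt_bundleCoord hφ ((hsm t ht).mdifferentiableWithinAt (by simp))
    (hsrc t ht)
  have h2 : HasDerivWithinAt α (localField g W U φ (α t)) (Ioo a b) t :=
    (hα t ht).1.hasDerivWithinAt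
  have h3 := (h2.congr (fun s hs => bundleCoord_bundlePoint hφ (hα s hs).2)
    (bundleCoord_bundlePoint hφ (hα t ht).2))
  rw [bundleCoord_bundlePoint hφ (hα t ht).2]
  exact (isOpen_Ioo.uniqueDiffWithinAt ht).eq_deriv _ h1 h3

/-- `x₀` need not lie on the leaf, and `ε` depends neither on `x` nor on `t₀`. This uniformity is
what allows an orbit to be continued past a finite time. -/
theorem exists_local_orbit (hU : ContMDiff (𝓡 n) 𝓘(ℝ, ℝ) ∞ U) (x₀ : CotangentBundle n Q) :
    ∃ N ∈ 𝓝 x₀, ∃ ε > (0 : ℝ), ∀ x ∈ N, x ∈ physicalLeaf g W (hamiltonian g U) → ∀ t₀ : ℝ,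
      ∃ σ : ℝ → CotangentBundle n Q,
        IsPhysicalOrbit g W (hamiltonian g U) (Ioo (t₀ - ε) (t₀ + ε)) σ ∧ σ t₀ = x := by
  have hφ := IsManifold.chart_mem_maximalAtlas (I := 𝓡 n) (n := ∞) x₀.1
  have hx₀ := mem_chart_source (Model n) x₀.1
  set φ := chartAt (Model n) x₀.1
  obtain ⟨r, hr, ε, hε, h⟩ := exists_local_flow (bundleChart φ hφ).open_target
    (contDiffOn_localField (g := g) (W := W) hφ hU) ((bundleChart φ hφ).map_source hx₀)
  refine ⟨(bundleChart φ hφ).source ∩ bundleChart φ hφ ⁻¹' Metric.closedBall _ r,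
    inter_mem ((bundleChart φ hφ).open_source.mem_nhds hx₀)
      (((bundleChart φ hφ).continuousAt hx₀).preimage_mem_nhds
        (Metric.closedBall_mem_nhds _ hr)), ε, hε, ?_⟩
  rintro x ⟨hxs, hxb⟩ hxl t₀
  obtain ⟨α, hα0, hα⟩ := h _ hxb
  have hl := comp_localProj_eq_of_hasDerivAt hφ hU (fun t ht => ⟨(hα t ht).1, (hα t ht).2.1⟩)
    (by rw [hα0]; exact (mem_physicalLeaf_iff_bundleCoord hφ hxs).1 hxl)
  have hmem : ∀ t ∈ Ioo (t₀ - ε) (t₀ + ε), t - t₀ ∈ Ioo (-ε) ε := fun t ht =>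
    ⟨by linarith [ht.1], by linarith [ht.2]⟩
  refine ⟨_, isPhysicalOrbit_bundlePoint hU hφ (α := fun t => α (t - t₀))
    (fun t ht => ⟨(hα _ (hmem t ht)).1.comp_sub_const t t₀, (hα _ (hmem t ht)).2.1⟩)
    (fun t ht => hl _ (hmem t ht)), ?_⟩
  simp only [sub_self, hα0]
  exact bundlePoint_bundleCoord hφ hxs

/-! ### Locality -/

/-- Being an orbit is a local property relative to `J`. Restrictions and glued curves are all
verified through it. -/
theorem isPhysicalOrbit_of_locally {H : CotangentBundle n Q → ℝ} {J : Set ℝ}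
    {γ : ℝ → CotangentBundle n Q} (hJ : UniqueDiffOn ℝ J)
    (h : ∀ t ∈ J, ∃ (J' : Set ℝ) (γ' : ℝ → CotangentBundle n Q), IsPhysicalOrbit g W H J' γ' ∧
      J' ∈ 𝓝[J] t ∧ γ =ᶠ[𝓝[J] t] γ') : IsPhysicalOrbit g W H J γ := by
  refine ⟨fun t ht => ?_, fun t ht => ?_, fun t ht => ?_⟩
  all_goals
    obtain ⟨J', γ', ho, hJ', hγ⟩ := h t ht
    have htJ' : t ∈ J' := mem_of_mem_nhdsWithin ht hJ'
    have hγt : γ t = γ' t := hγ.self_of_nhdsWithin ht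
  · exact ((ho.smooth t htJ').mono_of_mem_nhdsWithin hJ').congr_of_eventuallyEq hγ hγt
  · rw [hγt]
    exact ho.mem_leaf t htJ'
  · refine (ho.relations t htJ').congr hγt ?_
    have h1 := hγ.mfderivWithin_eq (I := 𝓘(ℝ, ℝ)) (I' := cotangentModel n) hγt
    have h2 := ((ho.smooth t htJ').mdifferentiableWithinAt
      (by simp)).mfderivWithin_mono_of_mem_nhdsWithin (hJ t ht).uniqueMDiffWithinAt hJ'
    exact DFunLike.congr_fun (h1.trans h2) (1 : ℝ)

theorem IsPhysicalOrbit.mono {H : CotangentBundle n Q → ℝ} {J J' : Set ℝ}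
    {γ : ℝ → CotangentBundle n Q} (h : IsPhysicalOrbit g W H J' γ) (hJ : UniqueDiffOn ℝ J)
    (hJJ' : J ⊆ J') : IsPhysicalOrbit g W H J γ :=
  isPhysicalOrbit_of_locally hJ fun _ _ =>
    ⟨J', γ, h, mem_of_superset self_mem_nhdsWithin hJJ', .rfl⟩

/-! ### The vector field along the physical leaf -/

/-- The tangent vector at `x` with coordinates `w` in the bundle chart of `φ`. -/
def vectorOfCoord (φ : OpenPartialHomeomorph Q (Model n)) (x : CotangentBundle n Q)
    (w : Model n × DualModel n) : TangentSpace (cotangentModel n) x :=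
  mfderiv 𝓘(ℝ, Model n × DualModel n) (cotangentModel n)
    (fun y : Model n × DualModel n => (bundlePoint φ y.1 y.2 : CotangentBundle n Q))
    (bundleCoord φ x) w

theorem velocityCoord_vectorOfCoord (hφ : φ ∈ IsManifold.maximalAtlas (𝓡 n) ∞ Q)
    {x : CotangentBundle n Q} (hx : x.1 ∈ φ.source) (w : Model n × DualModel n) :
    velocityCoord φ x (vectorOfCoord φ x w) = w := by
  have h := (bundleChart_mdifferentiable hφ).comp_symm_deriv ((bundleChart φ hφ).map_source
    (x := x) hx)
  rw [(bundleChart φ hφ).left_inv hx] at h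
  exact DFunLike.congr_fun h w

theorem contMDiffOn_vectorOfCoord (hφ : φ ∈ IsManifold.maximalAtlas (𝓡 n) ∞ Q)
    {F : Model n × DualModel n → Model n × DualModel n}
    (hF : ContDiffOn ℝ ∞ F (φ.target ×ˢ univ)) :
    ContMDiffOn (cotangentModel n) (cotangentModel n).tangent ∞
      (fun y => (⟨y, vectorOfCoord φ y (F (bundleCoord φ y))⟩ :
        TangentBundle (cotangentModel n) (CotangentBundle n Q))) (bundleChart φ hφ).source := by
  have hmaps : MapsTo (bundleCoord φ) (bundleChart φ hφ).source (φ.target ×ˢ univ) :=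
    (bundleChart φ hφ).mapsTo
  have h1 := (contMDiffOn_bundlePoint hφ).contMDiffOn_tangentMapWithin
    (m := ∞) (by simp) (bundleChart φ hφ).open_target.uniqueMDiffOn
  have h0 : ContMDiffOn (cotangentModel n) 𝓘(ℝ, Model n × DualModel n).tangent ∞
      (fun y => (⟨bundleCoord φ y, F (bundleCoord φ y)⟩ :
        TangentBundle 𝓘(ℝ, Model n × DualModel n) (Model n × DualModel n)))
      (bundleChart φ hφ).source := by
    intro y hy
    rw [contMDiffWithinAt_totalSpace]
    refine ⟨contMDiffOn_bundleCoord hφ y hy, ?_⟩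
    have h : ContMDiffWithinAt (cotangentModel n) 𝓘(ℝ, Model n × DualModel n) ∞
        (fun x => F (bundleCoord φ x)) (bundleChart φ hφ).source y :=
      (hF.contMDiffOn.comp (contMDiffOn_bundleCoord hφ) hmaps) y hy
    simpa using h
  refine (h1.comp h0 hmaps).congr fun y hy => ?_
  have key : ∀ y' : CotangentBundle n Q, y' = y →
      (⟨y, vectorOfCoord φ y (F (bundleCoord φ y))⟩ :
        TangentBundle (cotangentModel n) (CotangentBundle n Q)) =
        ⟨y', mfderiv 𝓘(ℝ, Model n × DualModel n) (cotangentModel n)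
          (fun y : Model n × DualModel n => (bundlePoint φ y.1 y.2 : CotangentBundle n Q))
          (bundleCoord φ y) (F (bundleCoord φ y))⟩ := by
    rintro _ rfl
    rfl
  simp only [Function.comp, tangentMapWithin]
  rw [mfderivWithin_of_isOpen (φ.open_target.prod isOpen_univ) (hmaps hy)]
  exact key _ ((bundleChart φ hφ).left_inv hy)

theorem velocityCoord_eq_localField_of_tangent (hU : ContMDiff (𝓡 n) 𝓘(ℝ, ℝ) ∞ U)
    (hφ : φ ∈ IsManifold.maximalAtlas (𝓡 n) ∞ Q) {x : CotangentBundle n Q} (hx : x.1 ∈ φ.source)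
    {v : TangentSpace (cotangentModel n) x}
    (ht : (⟨x, v⟩ : TangentBundle (cotangentModel n) (CotangentBundle n Q)) ∈
      tangentVectors (physicalLeaf g W (hamiltonian g U)))
    (hr : SatisfiesRelations g W (hamiltonian g U) x v) :
    velocityCoord φ x v = localField g W U φ (bundleCoord φ x) := by
  obtain ⟨ε, hε, σ, hσ, hσl, he⟩ := ht
  have h0 : (0 : ℝ) ∈ Ioo (-ε) ε := ⟨by linarith, hε⟩
  have hd := mfderivWithin_of_isOpen (I := 𝓘(ℝ, ℝ)) (I' := cotangentModel n) (f := σ)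
    isOpen_Ioo h0
  rw [← hd] at he
  cases he
  exact localRelations_eq_localField hU hφ ((hσ 0 h0).mdifferentiableWithinAt (by simp))
    (isOpen_Ioo.uniqueDiffWithinAt h0) h0 (eventually_mem_nhdsWithin.mono hσl) hr hx

/-- The local orbit through `x` is the required curve in the leaf, and injectivity of
`velocityCoord` identifies its velocity with `v`. -/
theorem mem_tangentVectors_of_velocityCoord (hU : ContMDiff (𝓡 n) 𝓘(ℝ, ℝ) ∞ U)
    (hφ : φ ∈ IsManifold.maximalAtlas (𝓡 n) ∞ Q) {x : CotangentBundle n Q} (hx : x.1 ∈ φ.source)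
    (hxl : x ∈ physicalLeaf g W (hamiltonian g U)) {v : TangentSpace (cotangentModel n) x}
    (hv : velocityCoord φ x v = localField g W U φ (bundleCoord φ x)) :
    (⟨x, v⟩ : TangentBundle (cotangentModel n) (CotangentBundle n Q)) ∈
      tangentVectors (physicalLeaf g W (hamiltonian g U)) := by
  obtain ⟨N, hN, ε, hε, h⟩ := exists_local_orbit (g := g) (W := W) hU x
  obtain ⟨σ, hσ, rfl⟩ := h x (mem_of_mem_nhds hN) hxl 0
  rw [zero_sub, zero_add] at hσ
  have h0 : (0 : ℝ) ∈ Ioo (-ε) ε := ⟨by linarith, hε⟩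
  refine ⟨ε, hε, σ, hσ.smooth, hσ.mem_leaf, ?_⟩
  have hd := mfderivWithin_of_isOpen (I := 𝓘(ℝ, ℝ)) (I' := cotangentModel n) (f := σ)
    isOpen_Ioo h0
  have h1 := localRelations_eq_localField hU hφ
    ((hσ.smooth 0 h0).mdifferentiableWithinAt (by simp))
    (isOpen_Ioo.uniqueDiffWithinAt h0) h0 (eventually_mem_nhdsWithin.mono hσ.mem_leaf)
    (hσ.relations 0 h0) hx
  rw [← hd, (velocityCoord_bijective hφ hx).1 (hv.trans h1.symm)]

theorem exists_unique_field (hU : ContMDiff (𝓡 n) 𝓘(ℝ, ℝ) ∞ U) :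
    ∃ X : (x : CotangentBundle n Q) → TangentSpace (cotangentModel n) x,
      (∀ x ∈ physicalLeaf g W (hamiltonian g U), ∀ v : TangentSpace (cotangentModel n) x,
        ((⟨x, v⟩ : TangentBundle (cotangentModel n) (CotangentBundle n Q)) ∈
            tangentVectors (physicalLeaf g W (hamiltonian g U)) ∧
          SatisfiesRelations g W (hamiltonian g U) x v) ↔ v = X x) ∧
      IsSmoothFieldAlong (physicalLeaf g W (hamiltonian g U)) X := by
  let X : (x : CotangentBundle n Q) → TangentSpace (cotangentModel n) x := fun x =>
    vectorOfCoord (chartAt (Model n) x.1) x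
      (localField g W U (chartAt (Model n) x.1) (bundleCoord (chartAt (Model n) x.1) x))
  have hatlas : ∀ x : CotangentBundle n Q,
      chartAt (Model n) x.1 ∈ IsManifold.maximalAtlas (𝓡 n) ∞ Q := fun x =>
    IsManifold.chart_mem_maximalAtlas x.1
  have hsrc : ∀ x : CotangentBundle n Q, x.1 ∈ (chartAt (Model n) x.1).source := fun x =>
    mem_chart_source _ _
  have hX : ∀ x : CotangentBundle n Q, velocityCoord (chartAt (Model n) x.1) x (X x) =
      localField g W U (chartAt (Model n) x.1) (bundleCoord (chartAt (Model n) x.1) x) := fun x =>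
    velocityCoord_vectorOfCoord (hatlas x) (hsrc x) _
  have hiff : ∀ x ∈ physicalLeaf g W (hamiltonian g U), ∀ v : TangentSpace (cotangentModel n) x,
      ((⟨x, v⟩ : TangentBundle (cotangentModel n) (CotangentBundle n Q)) ∈
          tangentVectors (physicalLeaf g W (hamiltonian g U)) ∧
        SatisfiesRelations g W (hamiltonian g U) x v) ↔ v = X x := by
    intro x hx v
    constructor
    · rintro ⟨h1, h2⟩
      exact (velocityCoord_bijective (hatlas x) (hsrc x)).1
        ((velocityCoord_eq_localField_of_tangent hU (hatlas x) (hsrc x) h1 h2).trans (hX x).symm)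
    · rintro rfl
      exact ⟨mem_tangentVectors_of_velocityCoord hU (hatlas x) (hsrc x) hx (hX x),
        satisfiesRelations_of_velocityCoord hU (hatlas x) (hsrc x) hx (hX x)⟩
  refine ⟨X, hiff, fun x hx => ⟨(bundleChart _ (hatlas x)).source,
    (bundleChart _ (hatlas x)).open_source, hsrc x, _, contMDiffOn_vectorOfCoord (hatlas x)
      (contDiffOn_localField (g := g) (W := W) (hatlas x) hU), ?_⟩⟩
  rintro y ⟨hy, hyl⟩
  refine (velocityCoord_bijective (hatlas x) hy).1
    ((velocityCoord_vectorOfCoord (hatlas x) hy _).trans ?_)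
  -- `X` was built with a chart that changes from point to point. Being tangent and satisfying the
  -- relations, it has coordinates `localField` in every chart, in particular in the one fixed
  -- around `x`.
  obtain ⟨h1, h2⟩ := (hiff y hyl (X y)).2 rfl
  exact (velocityCoord_eq_localField_of_tangent hU (hatlas x) hy h1 h2).symm

/-! ### Uniqueness of orbits -/

/-- Points of one fibre are separated by a bundle chart, points of different fibres by their
projections. -/
instance [T2Space Q] : T2Space (CotangentBundle n Q) := by
  rw [t2Space_iff_disjoint_nhds]
  intro x y hne
  by_cases hb : x.1 = y.1
  · have hφ := IsManifold.chart_mem_maximalAtlas (I := 𝓡 n) (n := ∞) x.1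
    have hx : x ∈ (bundleChart _ hφ).source := mem_chart_source (Model n) x.1
    have hy : y ∈ (bundleChart _ hφ).source := by
      change y.1 ∈ (chartAt (Model n) x.1).source
      rw [← hb]
      exact mem_chart_source (Model n) x.1
    exact ((bundleChart _ hφ).continuousAt hx).disjoint
      (disjoint_nhds_nhds.2 fun h => hne ((bundleChart _ hφ).injOn hx hy h))
      ((bundleChart _ hφ).continuousAt hy)
  · have hc := FiberBundle.continuous_proj (DualModel n) (CotangentSpace n : Q → Type)
    exact (hc.tendsto x).disjoint (disjoint_nhds_nhds.2 hb) (hc.tendsto y)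

theorem IsPhysicalOrbit.eventuallyEq (hU : ContMDiff (𝓡 n) 𝓘(ℝ, ℝ) ∞ U) {J : Set ℝ}
    {γ₁ γ₂ : ℝ → CotangentBundle n Q} (hJ : J.OrdConnected) (hJu : UniqueDiffOn ℝ J)
    (h₁ : IsPhysicalOrbit g W (hamiltonian g U) J γ₁)
    (h₂ : IsPhysicalOrbit g W (hamiltonian g U) J γ₂) {t : ℝ} (ht : t ∈ J) (he : γ₁ t = γ₂ t) :
    γ₁ =ᶠ[𝓝[J] t] γ₂ := by
  have hφ := IsManifold.chart_mem_maximalAtlas (I := 𝓡 n) (n := ∞) (γ₁ t).1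
  have hts := mem_chart_source (Model n) (γ₁ t).1
  set φ := chartAt (Model n) (γ₁ t).1
  have hf : ContDiffAt ℝ 1 (localField g W U φ) (bundleCoord φ (γ₁ t)) :=
    ((contDiffOn_localField (g := g) (W := W) hφ hU).contDiffAt
      ((bundleChart φ hφ).open_target.mem_nhds
        ((bundleChart φ hφ).map_source hts))).of_le (WithTop.coe_le_coe.2 le_top)
  obtain ⟨K, s, hs, hlip⟩ := hf.exists_lipschitzOnWith
  have hO : (bundleChart φ hφ).source ∩ bundleChart φ hφ ⁻¹' s ∈ 𝓝 (γ₁ t) :=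
    inter_mem ((bundleChart φ hφ).open_source.mem_nhds hts)
      (((bundleChart φ hφ).continuousAt hts).preimage_mem_nhds hs)
  have hev : ∀ᶠ r in 𝓝[J] t, γ₁ r ∈ (bundleChart φ hφ).source ∩ bundleChart φ hφ ⁻¹' s ∧
      γ₂ r ∈ (bundleChart φ hφ).source ∩ bundleChart φ hφ ⁻¹' s :=
    have e₁ : ∀ᶠ r in 𝓝[J] t, γ₁ r ∈ (bundleChart φ hφ).source ∩ bundleChart φ hφ ⁻¹' s :=
      (h₁.smooth t ht).continuousWithinAt hO
    have e₂ : ∀ᶠ r in 𝓝[J] t, γ₂ r ∈ (bundleChart φ hφ).source ∩ bundleChart φ hφ ⁻¹' s :=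
      (h₂.smooth t ht).continuousWithinAt (he ▸ hO)
    e₁.and e₂
  obtain ⟨δ, hδ, hball⟩ := Metric.mem_nhdsWithin_iff.1 hev
  have hd : ∀ γ : ℝ → CotangentBundle n Q, IsPhysicalOrbit g W (hamiltonian g U) J γ →
      ∀ r ∈ J, (γ r).1 ∈ φ.source → HasDerivWithinAt (fun s => bundleCoord φ (γ s))
        (localField g W U φ (bundleCoord φ (γ r))) J r := fun γ hγ r hr hrs =>
    hγ.hasDerivWithinAt hU hφ (hJu r hr) hr hrs
  filter_upwards [inter_mem_nhdsWithin J (Metric.ball_mem_nhds t hδ)] with r hr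
  obtain ⟨hrJ, hrb⟩ := hr
  -- As `t` may be an endpoint of `J`, the two curves are compared on the segment from `t` to `r`,
  -- forwards or backwards, with one-sided derivatives.
  have hmem : uIcc t r ⊆ Metric.ball t δ ∩ J := fun a ha =>
    ⟨((convex_ball t δ).ordConnected.uIcc_subset (Metric.mem_ball_self hδ) hrb) ha,
      hJ.uIcc_subset ht hrJ ha⟩
  have key : EqOn (fun s => bundleCoord φ (γ₁ s)) (fun s => bundleCoord φ (γ₂ s)) (uIcc t r) := by
    have hg : ∀ a ∈ uIcc t r, (γ₁ a).1 ∈ φ.source ∧ bundleCoord φ (γ₁ a) ∈ s ∧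
        (γ₂ a).1 ∈ φ.source ∧ bundleCoord φ (γ₂ a) ∈ s := fun a ha =>
      have h := hball (hmem ha)
      ⟨h.1.1, h.1.2, h.2.1, h.2.2⟩
    have hc₁ : ContinuousOn (fun s => bundleCoord φ (γ₁ s)) (uIcc t r) := fun a ha =>
      (hd γ₁ h₁ a (hmem ha).2 (hg a ha).1).continuousWithinAt.mono fun b hb => (hmem hb).2
    have hc₂ : ContinuousOn (fun s => bundleCoord φ (γ₂ s)) (uIcc t r) := fun a ha =>
      (hd γ₂ h₂ a (hmem ha).2 (hg a ha).2.2.1).continuousWithinAt.mono fun b hb => (hmem hb).2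
    rcases le_total t r with htr | htr
    · rw [uIcc_of_le htr] at *
      have hn : ∀ a ∈ Ico t r, J ∈ 𝓝[Ici a] a := fun a ha =>
        mem_of_superset (Icc_mem_nhdsGE ha.2) fun b hb => (hmem ⟨ha.1.trans hb.1, hb.2⟩).2
      exact ODE_solution_unique_of_mem_Icc_right (v := fun _ => localField g W U φ)
        (s := fun _ => s) (fun _ _ => hlip) hc₁
        (fun a ha => (hd γ₁ h₁ a (hmem (Ico_subset_Icc_self ha)).2
          (hg a (Ico_subset_Icc_self ha)).1).mono_of_mem_nhdsWithin (hn a ha))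
        (fun a ha => (hg a (Ico_subset_Icc_self ha)).2.1) hc₂
        (fun a ha => (hd γ₂ h₂ a (hmem (Ico_subset_Icc_self ha)).2
          (hg a (Ico_subset_Icc_self ha)).2.2.1).mono_of_mem_nhdsWithin (hn a ha))
        (fun a ha => (hg a (Ico_subset_Icc_self ha)).2.2.2) (by rw [he])
    · rw [uIcc_of_ge htr] at *
      have hn : ∀ a ∈ Ioc r t, J ∈ 𝓝[Iic a] a := fun a ha =>
        mem_of_superset (Icc_mem_nhdsLE ha.1) fun b hb => (hmem ⟨hb.1, hb.2.trans ha.2⟩).2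
      exact ODE_solution_unique_of_mem_Icc_left (v := fun _ => localField g W U φ)
        (s := fun _ => s) (fun _ _ => hlip) hc₁
        (fun a ha => (hd γ₁ h₁ a (hmem (Ioc_subset_Icc_self ha)).2
          (hg a (Ioc_subset_Icc_self ha)).1).mono_of_mem_nhdsWithin (hn a ha))
        (fun a ha => (hg a (Ioc_subset_Icc_self ha)).2.1) hc₂
        (fun a ha => (hd γ₂ h₂ a (hmem (Ioc_subset_Icc_self ha)).2
          (hg a (Ioc_subset_Icc_self ha)).2.2.1).mono_of_mem_nhdsWithin (hn a ha))
        (fun a ha => (hg a (Ioc_subset_Icc_self ha)).2.2.2) (by rw [he])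
  have hr' := hball ⟨hrb, hrJ⟩
  exact (bundleChart φ hφ).injOn hr'.1.1 hr'.2.1 (key right_mem_uIcc)

/-- The set of times of agreement is closed by the Hausdorff property and open by local uniqueness,
and `J` is connected. -/
theorem IsPhysicalOrbit.eqOn [T2Space Q] (hU : ContMDiff (𝓡 n) 𝓘(ℝ, ℝ) ∞ U) {J : Set ℝ}
    {γ₁ γ₂ : ℝ → CotangentBundle n Q} (hJ : J.OrdConnected) (hJu : UniqueDiffOn ℝ J)
    (h₁ : IsPhysicalOrbit g W (hamiltonian g U) J γ₁)
    (h₂ : IsPhysicalOrbit g W (hamiltonian g U) J γ₂) {t₀ : ℝ} (ht₀ : t₀ ∈ J)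
    (he : γ₁ t₀ = γ₂ t₀) : EqOn γ₁ γ₂ J := by
  have : PreconnectedSpace J := Subtype.preconnectedSpace hJ.isPreconnected
  have hclopen : IsClopen {t : J | γ₁ t = γ₂ t} := by
    refine ⟨isClosed_eq h₁.smooth.continuousOn.domRestrict h₂.smooth.continuousOn.domRestrict, ?_⟩
    rw [isOpen_iff_mem_nhds]
    intro t ht
    have := h₁.eventuallyEq hU hJ hJu h₂ t.2 ht
    rw [nhds_subtype_eq_comap_nhdsWithin]
    exact preimage_mem_comap this
  have huniv := hclopen.eq_univ ⟨⟨t₀, ht₀⟩, he⟩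
  intro t ht
  exact (huniv ▸ mem_univ (⟨t, ht⟩ : J) : (⟨t, ht⟩ : J) ∈ {t : J | γ₁ t = γ₂ t})

/-! ### Half-open time intervals -/

theorem ordConnected_timeInterval (T : EReal) : (timeInterval T).OrdConnected :=
  ⟨fun _ ha _ hb _ hc =>
    ⟨ha.1.trans hc.1, (EReal.coe_le_coe_iff.2 hc.2).trans_lt hb.2⟩⟩

theorem zero_mem_timeInterval {T : EReal} (hT : 0 < T) : (0 : ℝ) ∈ timeInterval T :=
  ⟨le_rfl, hT⟩

theorem timeInterval_mono {T T' : EReal} (h : T ≤ T') : timeInterval T ⊆ timeInterval T' :=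
  fun _ ht => ⟨ht.1, ht.2.trans_le h⟩

theorem timeInterval_coe (τ : ℝ) : timeInterval τ = Ico 0 τ := by
  ext t
  simp [timeInterval]

theorem timeInterval_top : timeInterval ⊤ = Ici 0 := by
  ext t
  simp [timeInterval, EReal.coe_lt_top]

theorem uniqueDiffOn_timeInterval (T : EReal) : UniqueDiffOn ℝ (timeInterval T) := by
  rcases (timeInterval T).eq_empty_or_nonempty with h | ⟨t, ht⟩
  · rw [h]
    exact uniqueDiffOn_empty
  · obtain ⟨r, hr, hrT⟩ := EReal.lt_iff_exists_real_btwn.1 ht.2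
    have htr : t < r := EReal.coe_lt_coe_iff.1 hr
    refine uniqueDiffOn_convex (ordConnected_timeInterval T).convex ⟨(t + r) / 2, ?_⟩
    refine mem_interior.2 ⟨Ioo t r, fun s hs => ⟨ht.1.trans hs.1.le, ?_⟩, isOpen_Ioo,
      by linarith, by linarith⟩
    exact (EReal.coe_lt_coe_iff.2 hs.2).trans hrT

theorem timeInterval_mem_nhdsWithin {T T' : EReal} {t : ℝ} (ht : (t : EReal) < T') :
    timeInterval T' ∈ 𝓝[timeInterval T] t := by
  obtain ⟨r, hr, hrT⟩ := EReal.lt_iff_exists_real_btwn.1 ht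
  refine mem_of_superset (inter_mem_nhdsWithin (timeInterval T)
    (Iio_mem_nhds (EReal.coe_lt_coe_iff.1 hr))) fun s hs => ⟨hs.1.1, ?_⟩
  exact (EReal.coe_lt_coe_iff.2 hs.2).trans hrT

/-! ### Maximal orbits -/

theorem IsPhysicalOrbit.eqOn_timeInterval [T2Space Q] (hU : ContMDiff (𝓡 n) 𝓘(ℝ, ℝ) ∞ U)
    {T₁ T₂ : EReal} {γ₁ γ₂ : ℝ → CotangentBundle n Q}
    (h₁ : IsPhysicalOrbit g W (hamiltonian g U) (timeInterval T₁) γ₁)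
    (h₂ : IsPhysicalOrbit g W (hamiltonian g U) (timeInterval T₂) γ₂) (he : γ₁ 0 = γ₂ 0)
    {t : ℝ} (ht₁ : t ∈ timeInterval T₁) (ht₂ : t ∈ timeInterval T₂) : γ₁ t = γ₂ t := by
  have ht : t ∈ timeInterval (min T₁ T₂) := ⟨ht₁.1, lt_min ht₁.2 ht₂.2⟩
  exact (h₁.mono (uniqueDiffOn_timeInterval _) (timeInterval_mono (min_le_left _ _))).eqOn hU
    (ordConnected_timeInterval _) (uniqueDiffOn_timeInterval _)
    (h₂.mono (uniqueDiffOn_timeInterval _) (timeInterval_mono (min_le_right _ _)))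
    (zero_mem_timeInterval ((EReal.coe_le_coe_iff.2 ht.1).trans_lt ht.2)) he ht

theorem exists_maximal_orbit [T2Space Q] (hU : ContMDiff (𝓡 n) 𝓘(ℝ, ℝ) ∞ U)
    {x : CotangentBundle n Q} (hx : x ∈ physicalLeaf g W (hamiltonian g U)) :
    ∃ (T : EReal) (γ : ℝ → CotangentBundle n Q), 0 < T ∧
      IsPhysicalOrbit g W (hamiltonian g U) (timeInterval T) γ ∧ γ 0 = x ∧
      ∀ (T' : EReal) (γ' : ℝ → CotangentBundle n Q), 0 < T' →
        IsPhysicalOrbit g W (hamiltonian g U) (timeInterval T') γ' → γ' 0 = x →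
        T' ≤ T ∧ EqOn γ' γ (timeInterval T') := by
  let S : Set EReal := {T' | 0 < T' ∧ ∃ γ' : ℝ → CotangentBundle n Q,
    IsPhysicalOrbit g W (hamiltonian g U) (timeInterval T') γ' ∧ γ' 0 = x}
  obtain ⟨N, hN, ε, hε, h⟩ := exists_local_orbit (g := g) (W := W) hU x
  obtain ⟨σ, hσ, hσ0⟩ := h x (mem_of_mem_nhds hN) hx 0
  have hεS : (ε : EReal) ∈ S := by
    refine ⟨EReal.coe_pos.2 hε, σ, hσ.mono (uniqueDiffOn_timeInterval _) fun t ht => ?_, hσ0⟩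
    rw [timeInterval_coe] at ht
    exact ⟨by linarith [ht.1], by linarith [ht.2]⟩
  have hex : ∀ t ∈ timeInterval (sSup S), ∃ T' ∈ S, (t : EReal) < T' := fun t ht =>
    lt_sSup_iff.1 ht.2
  classical
  -- The maximal orbit is evaluated at `t` through some orbit that lives beyond `t`; by uniqueness
  -- the choice does not affect the value.
  choose! τ hτS hτ using hex
  have hS : ∀ T' ∈ S, ∃ γ' : ℝ → CotangentBundle n Q,
      IsPhysicalOrbit g W (hamiltonian g U) (timeInterval T') γ' ∧ γ' 0 = x := fun T' h => h.2
  have : Nonempty (CotangentBundle n Q) := ⟨x⟩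
  choose! Γ hΓ hΓ0 using hS
  have hpos : 0 < sSup S := (EReal.coe_pos.2 hε).trans_le (le_sSup hεS)
  have hagree : ∀ (T' : EReal) (γ' : ℝ → CotangentBundle n Q), 0 < T' →
      IsPhysicalOrbit g W (hamiltonian g U) (timeInterval T') γ' → γ' 0 = x →
      T' ≤ sSup S ∧ EqOn γ' (fun t => Γ (τ t) t) (timeInterval T') := by
    intro T' γ' hT' hγ' h0
    have hle : T' ≤ sSup S := le_sSup ⟨hT', γ', hγ', h0⟩
    refine ⟨hle, fun t ht => ?_⟩
    have ht' := timeInterval_mono hle ht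
    exact hγ'.eqOn_timeInterval hU (hΓ _ (hτS t ht')) (h0.trans (hΓ0 _ (hτS t ht')).symm) ht
      ⟨ht.1, hτ t ht'⟩
  refine ⟨sSup S, fun t => Γ (τ t) t, hpos, ?_, hΓ0 _ (hτS 0 (zero_mem_timeInterval hpos)), hagree⟩
  refine isPhysicalOrbit_of_locally (uniqueDiffOn_timeInterval _) fun t ht =>
    ⟨timeInterval (τ t), Γ (τ t), hΓ _ (hτS t ht), timeInterval_mem_nhdsWithin (hτ t ht), ?_⟩
  filter_upwards [timeInterval_mem_nhdsWithin (hτ t ht)] with s hs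
  exact ((hagree _ _ (hτS t ht).1 (hΓ _ (hτS t ht)) (hΓ0 _ (hτS t ht))).2 hs).symm

theorem IsPhysicalOrbit.exists_extension [T2Space Q] (hU : ContMDiff (𝓡 n) 𝓘(ℝ, ℝ) ∞ U)
    {τ t₁ ε : ℝ} {γ σ : ℝ → CotangentBundle n Q}
    (hγ : IsPhysicalOrbit g W (hamiltonian g U) (Ico 0 τ) γ)
    (hσ : IsPhysicalOrbit g W (hamiltonian g U) (Ioo (t₁ - ε) (t₁ + ε)) σ) (ht₁ : 0 < t₁)
    (ht₁τ : t₁ < τ) (hε : 0 < ε) (he : γ t₁ = σ t₁) :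
    ∃ γ' : ℝ → CotangentBundle n Q,
      IsPhysicalOrbit g W (hamiltonian g U) (Ico 0 (t₁ + ε)) γ' ∧ γ' 0 = γ 0 := by
  -- The curves meet at `t₁`, hence agree on their open overlap. So the curve that switches from `γ`
  -- to `σ` at `t₁` equals `σ` near `t₁` and is smooth there.
  have hagree : EqOn γ σ (Ioo (max 0 (t₁ - ε)) (min τ (t₁ + ε))) :=
    (hγ.mono isOpen_Ioo.uniqueDiffOn fun s hs =>
      ⟨(le_max_left _ _).trans hs.1.le, hs.2.trans_le (min_le_left _ _)⟩).eqOn hU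
      ordConnected_Ioo isOpen_Ioo.uniqueDiffOn
      (hσ.mono isOpen_Ioo.uniqueDiffOn fun s hs =>
        ⟨(le_max_right _ _).trans_lt hs.1, hs.2.trans_le (min_le_right _ _)⟩)
      ⟨max_lt ht₁ (by linarith), lt_min ht₁τ (by linarith)⟩ he
  have hu : UniqueDiffOn ℝ (Ico 0 (t₁ + ε)) := by
    rw [← timeInterval_coe]
    exact uniqueDiffOn_timeInterval _
  refine ⟨fun s => if s < t₁ then γ s else σ s, isPhysicalOrbit_of_locally hu fun t ht => ?_,
    if_pos ht₁⟩
  rcases lt_or_ge t t₁ with htt | htt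
  · refine ⟨Ico 0 τ, γ, hγ, ?_, ?_⟩
    · filter_upwards [inter_mem_nhdsWithin (Ico 0 (t₁ + ε)) (Iio_mem_nhds htt)] with s hs
      exact ⟨hs.1.1, (show s < t₁ from hs.2).trans ht₁τ⟩
    · filter_upwards [inter_mem_nhdsWithin (Ico 0 (t₁ + ε)) (Iio_mem_nhds htt)] with s hs
      exact if_pos hs.2
  · have hlt : max 0 (t₁ - ε) < t := max_lt (by linarith) (by linarith)
    refine ⟨Ioo (t₁ - ε) (t₁ + ε), σ, hσ, ?_, ?_⟩
    · filter_upwards [inter_mem_nhdsWithin (Ico 0 (t₁ + ε)) (Ioi_mem_nhds hlt)] with s hs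
      exact ⟨(le_max_right _ _).trans_lt hs.2, hs.1.2⟩
    · filter_upwards [inter_mem_nhdsWithin (Ico 0 (t₁ + ε)) (Ioi_mem_nhds hlt)] with s hs
      by_cases hst : s < t₁
      · rw [if_pos hst]
        exact hagree ⟨hs.2, lt_min (hst.trans ht₁τ) (by linarith)⟩
      · exact if_neg hst

/-- A maximal orbit with a finite life time leaves every compact set. -/
theorem IsPhysicalOrbit.eventually_notMem [T2Space Q] (hU : ContMDiff (𝓡 n) 𝓘(ℝ, ℝ) ∞ U)
    {T : EReal} {γ : ℝ → CotangentBundle n Q} (hT0 : 0 < T) (hT : T < ⊤)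
    (hγ : IsPhysicalOrbit g W (hamiltonian g U) (timeInterval T) γ)
    (hmax : ∀ (T' : EReal) (γ' : ℝ → CotangentBundle n Q), 0 < T' →
        IsPhysicalOrbit g W (hamiltonian g U) (timeInterval T') γ' → γ' 0 = γ 0 → T' ≤ T)
    {K : Set (CotangentBundle n Q)} (hK : IsCompact K) :
    ∃ t₀ ∈ timeInterval T, ∀ t ∈ timeInterval T, t₀ ≤ t → γ t ∉ K := by
  lift T to ℝ using ⟨hT.ne, (EReal.bot_lt_zero.trans hT0).ne'⟩ with τ
  have hτ : 0 < τ := EReal.coe_pos.1 hT0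
  rw [timeInterval_coe] at *
  by_contra! hfr
  have hfreq : ∃ᶠ t in 𝓝[<] τ, γ t ∈ K := by
    rw [frequently_iff]
    intro V hV
    obtain ⟨l, hl, hlV⟩ := (mem_nhdsLT_iff_exists_Ioo_subset' hτ).1 hV
    obtain ⟨m, hlm, hm⟩ := exists_between (mem_Iio.1 hl)
    obtain ⟨t, ht, hmt, htK⟩ := hfr (max 0 m) ⟨le_max_left _ _, max_lt hτ hm⟩
    exact ⟨t, hlV ⟨hlm.trans_le ((le_max_right _ _).trans hmt), ht.2⟩, htK⟩
  obtain ⟨a, -, ha⟩ := hK.exists_mapClusterPt_of_frequently hfreq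
  obtain ⟨N, hN, ε, hε, h⟩ := exists_local_orbit (g := g) (W := W) hU a
  -- Restarting from a time `t₁ > τ - ε/2` at which the orbit is near the cluster point `a` prolongs
  -- it to `t₁ + ε > τ`, against maximality.
  have hnear : Ioo (max 0 (τ - ε / 2)) τ ∈ 𝓝[<] τ := Ioo_mem_nhdsLT (max_lt hτ (by linarith))
  obtain ⟨t₁, ht₁N, ht₁⟩ := ((ha.frequently hN).and_eventually hnear).exists
  have h0 : 0 < t₁ := (le_max_left _ _).trans_lt ht₁.1
  have h1 : τ - ε / 2 < t₁ := (le_max_right _ _).trans_lt ht₁.1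
  obtain ⟨σ, hσ, hσe⟩ := h (γ t₁) ht₁N (hγ.mem_leaf t₁ ⟨h0.le, ht₁.2⟩) t₁
  obtain ⟨γ', hγ', he⟩ := hγ.exists_extension hU hσ h0 ht₁.2 hε hσe.symm
  rw [← timeInterval_coe] at hγ'
  have := EReal.coe_le_coe_iff.1 (hmax _ γ' (EReal.coe_pos.2 (by linarith)) hγ' he)
  linarith

/-! ### Conservation of energy -/

theorem hamiltonian_eq_localHamiltonian (hφ : φ ∈ IsManifold.maximalAtlas (𝓡 n) ∞ Q)
    {x : CotangentBundle n Q} (hx : x.1 ∈ φ.source) :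
    hamiltonian g U x = localHamiltonian g U φ (bundleCoord φ x) := by
  rw [localHamiltonian, bundlePoint_bundleCoord hφ hx]

/-- The velocity has its base part in `W`, so it is an admissible test vector against itself, and
`ω` is alternating. -/
theorem fderiv_localHamiltonian_localField (hU : ContMDiff (𝓡 n) 𝓘(ℝ, ℝ) ∞ U)
    (hφ : φ ∈ IsManifold.maximalAtlas (𝓡 n) ∞ Q) {y : Model n × DualModel n}
    (hy : y.1 ∈ φ.target) (hyl : y.2.comp (localProj g W φ y.1) = y.2) :
    fderiv ℝ (localHamiltonian g U φ) y (localField g W U φ y) = 0 := by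
  rw [← (localRelations_iff_symplectic hφ hU hy).1 (localRelations_localField hφ hy hyl)
    (localField g W U φ y), sub_self]
  exact DFunLike.congr_fun (localProj_localProj (g := g) (W := W) hφ hy) _

theorem IsPhysicalOrbit.hasDerivWithinAt_hamiltonian (hU : ContMDiff (𝓡 n) 𝓘(ℝ, ℝ) ∞ U)
    {γ : ℝ → CotangentBundle n Q} {J : Set ℝ} {t : ℝ}
    (hγ : IsPhysicalOrbit g W (hamiltonian g U) J γ) (hJ : UniqueDiffWithinAt ℝ J t)
    (ht : t ∈ J) : HasDerivWithinAt (fun s => hamiltonian g U (γ s)) 0 J t := by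
  have hφ := IsManifold.chart_mem_maximalAtlas (I := 𝓡 n) (n := ∞) (γ t).1
  have hts := mem_chart_source (Model n) (γ t).1
  set φ := chartAt (Model n) (γ t).1
  have hy : (bundleCoord φ (γ t)).1 ∈ φ.target := φ.map_source hts
  have hH : HasFDerivAt (localHamiltonian g U φ)
      (fderiv ℝ (localHamiltonian g U φ) (bundleCoord φ (γ t))) (bundleCoord φ (γ t)) :=
    (((contDiffOn_localHamiltonian (g := g) hφ hU).contDiffAt
    ((bundleChart φ hφ).open_target.mem_nhds
      ((bundleChart φ hφ).map_source hts))).differentiableAt (by simp)).hasFDerivAt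
  have h := hH.comp_hasDerivWithinAt t (hγ.hasDerivWithinAt hU hφ hJ ht hts)
  rw [fderiv_localHamiltonian_localField hU hφ hy
    ((mem_physicalLeaf_iff_bundleCoord hφ hts).1 (hγ.mem_leaf t ht))] at h
  have hsrc : ∀ᶠ s in 𝓝[J] t, (γ s).1 ∈ φ.source :=
    (hγ.smooth t ht).continuousWithinAt ((bundleChart φ hφ).open_source.mem_nhds (x := γ t) hts)
  exact h.congr_of_eventuallyEq (hsrc.mono fun s hs => hamiltonian_eq_localHamiltonian hφ hs)
    (hamiltonian_eq_localHamiltonian hφ hts)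

theorem IsPhysicalOrbit.hamiltonian_eq (hU : ContMDiff (𝓡 n) 𝓘(ℝ, ℝ) ∞ U)
    {γ : ℝ → CotangentBundle n Q} {J : Set ℝ} (hγ : IsPhysicalOrbit g W (hamiltonian g U) J γ)
    (hJ : J.OrdConnected) (hJu : UniqueDiffOn ℝ J) {s t : ℝ} (hs : s ∈ J) (ht : t ∈ J) :
    hamiltonian g U (γ t) = hamiltonian g U (γ s) := by
  have h := hJ.convex.norm_image_sub_le_of_norm_hasDerivWithin_le (C := 0)
    (fun r hr => hγ.hasDerivWithinAt_hamiltonian hU (hJu r hr) hr) (by simp) hs ht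
  rw [zero_mul] at h
  exact sub_eq_zero.1 (norm_le_zero_iff.1 h)

/-! ### The speed of the base path -/

theorem contMDiff_cotangentBundle_proj :
    ContMDiff (cotangentModel n) (𝓡 n) ∞ (fun x : CotangentBundle n Q => x.1) :=
  Bundle.contMDiff_proj (CotangentSpace n : Q → Type)

/-- Hence the squared speed of the base path is `g*(p, p)`, which the energy controls. -/
theorem IsPhysicalOrbit.mfderiv_proj (hU : ContMDiff (𝓡 n) 𝓘(ℝ, ℝ) ∞ U)
    {γ : ℝ → CotangentBundle n Q} {J : Set ℝ} {t : ℝ}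
    (hγ : IsPhysicalOrbit g W (hamiltonian g U) J γ) (ht : J ∈ 𝓝 t) :
    mfderiv 𝓘(ℝ, ℝ) (𝓡 n) (fun s => (γ s).1) t (1 : ℝ) = sharp g (γ t).1 (γ t).2 := by
  have hφ := IsManifold.chart_mem_maximalAtlas (I := 𝓡 n) (n := ∞) (γ t).1
  have hts := mem_chart_source (Model n) (γ t).1
  set φ := chartAt (Model n) (γ t).1
  have htJ := mem_of_mem_nhds ht
  have hy : (bundleCoord φ (γ t)).1 ∈ φ.target := φ.map_source hts
  have hq : MDifferentiableAt 𝓘(ℝ, ℝ) (𝓡 n) (fun s => (γ s).1) t :=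
    (contMDiff_cotangentBundle_proj.contMDiffAt.comp t
      ((hγ.smooth t htJ).contMDiffAt ht)).mdifferentiableAt (by simp)
  have h1 := ((chart_mdifferentiable hφ).mdifferentiableAt hts).hasMFDerivAt.comp t
    hq.hasMFDerivAt
  have h2 : HasFDerivAt (𝕜 := ℝ) (E := ℝ) (F := Model n) (fun s => φ (γ s).1) _ t :=
    hasMFDerivAt_iff_hasFDerivAt.1 h1
  have h3 := (hγ.hasDerivWithinAt hU hφ (uniqueDiffWithinAt_of_mem_nhds ht) htJ
    hts).hasDerivAt ht
  have h4 : HasDerivAt (fun s => φ (γ s).1) (localField g W U φ (bundleCoord φ (γ t))).1 t :=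
    h3.fst
  have h5 : chartDiff φ (γ t).1 (mfderiv 𝓘(ℝ, ℝ) (𝓡 n) (fun s => (γ s).1) t (1 : ℝ)) =
      (localField g W U φ (bundleCoord φ (γ t))).1 := h2.hasDerivAt.unique h4
  have h6 : (localField g W U φ (bundleCoord φ (γ t))).1 =
      chartDiff φ (γ t).1 (sharp g (γ t).1 (γ t).2) := by
    rw [← partialP_eq_chartDiff_sharp (U := U) hφ hts, partialP_eq]
    exact localProj_localSharp hφ hy
      ((mem_physicalLeaf_iff_bundleCoord hφ hts).1 (hγ.mem_leaf t htJ))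
  have h7 := congrArg (chartFrame φ (γ t).1) (h5.trans h6)
  rwa [chartFrame_chartDiff hφ hts, chartFrame_chartDiff hφ hts] at h7

theorem IsPhysicalOrbit.riemannianEDist_le (hU : ContMDiff (𝓡 n) 𝓘(ℝ, ℝ) ∞ U)
    {γ : ℝ → CotangentBundle n Q} {J : Set ℝ}
    (hγ : IsPhysicalOrbit g W (hamiltonian g U) J γ) {C : ℝ} (hC : 0 ≤ C)
    (hp : ∀ t ∈ J, cometric g (γ t).1 (γ t).2 (γ t).2 ≤ C ^ 2) {s t : ℝ} (hst : s ≤ t)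
    (hJ : Icc s t ⊆ J) :
    letI : RiemannianBundle (fun q : Q => TangentSpace (𝓡 n) q) := ⟨g.toRiemannianMetric⟩
    Manifold.riemannianEDist (𝓡 n) (γ s).1 (γ t).1 ≤ ENNReal.ofReal (C * (t - s)) := by
  let : RiemannianBundle (fun q : Q => TangentSpace (𝓡 n) q) := ⟨g.toRiemannianMetric⟩
  have hsm : ContMDiffOn 𝓘(ℝ, ℝ) (𝓡 n) 1 (fun r => (γ r).1) (Icc s t) :=
    ((contMDiff_cotangentBundle_proj.comp_contMDiffOn hγ.smooth).mono hJ).of_le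
      (WithTop.coe_le_coe.2 le_top)
  have hnorm : ∀ (q : Q) (v : TangentSpace (𝓡 n) q), g.inner q v v ≤ C ^ 2 →
      ‖v‖ₑ ≤ ENNReal.ofReal C := by
    intro q v hv
    rw [← ofReal_norm]
    refine ENNReal.ofReal_le_ofReal (abs_le_of_sq_le_sq' ?_ hC).2
    rw [← real_inner_self_eq_norm_sq]
    exact hv
  have hb : ∀ r ∈ Ioo s t,
      ‖mfderiv 𝓘(ℝ, ℝ) (𝓡 n) (fun r => (γ r).1) r (1 : ℝ)‖ₑ ≤ ENNReal.ofReal C := by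
    intro r hr
    refine hnorm _ _ ?_
    rw [hγ.mfderiv_proj hU (mem_of_superset (Icc_mem_nhds hr.1 hr.2) hJ)]
    exact hp r (hJ (Ioo_subset_Icc_self hr))
  refine (Manifold.riemannianEDist_le_pathELength hsm rfl rfl hst).trans ?_
  rw [Manifold.pathELength_eq_lintegral_mfderiv_Ioo]
  refine (MeasureTheory.setLIntegral_mono measurable_const hb).trans ?_
  rw [MeasureTheory.setLIntegral_const, Real.volume_Ioo, ENNReal.ofReal_mul hC]

/-! ### Completeness -/

instance : NormedAddCommGroup (Model n →L[ℝ] DualModel n) :=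
  ContinuousLinearMap.toNormedAddCommGroup

/-- By Cauchy–Schwarz `p(u)² ≤ g*(p, p) g(u, u) ≤ A M ‖u‖²`. -/
theorem norm_bundleCoord_snd_le {x : CotangentBundle n Q} (hx : x.1 ∈ φ.source) {A M : ℝ}
    (hA : cometric g x.1 x.2 x.2 ≤ A) (hM : ‖localMetric g φ (φ x.1)‖ ≤ M) (hA0 : 0 ≤ A) :
    ‖(bundleCoord φ x).2‖ ≤ √(A * M) := by
  have hM0 : 0 ≤ M := (norm_nonneg _).trans hM
  refine ContinuousLinearMap.opNorm_le_bound _ (Real.sqrt_nonneg _) fun u => ?_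
  have h1 := sq_apply_le (g := g) x.2 (chartFrame φ x.1 u)
  have h2 : g.inner x.1 (chartFrame φ x.1 u) (chartFrame φ x.1 u) =
      localMetric g φ (φ x.1) u u := by
    rw [localMetric_apply, φ.left_inv hx]
  have h3 : localMetric g φ (φ x.1) u u ≤ M * ‖u‖ ^ 2 := by
    refine (le_abs_self _).trans (((localMetric g φ (φ x.1)).le_opNorm₂ u u).trans ?_)
    rw [mul_assoc, ← sq]
    gcongr
  have h4 : 0 ≤ localMetric g φ (φ x.1) u u := by
    rw [← h2]
    rcases eq_or_ne (chartFrame φ x.1 u) 0 with h | h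
    · rw [h]
      simp
    · exact (g.pos _ _ h).le
  rw [h2] at h1
  have h5 : ((bundleCoord φ x).2 u) ^ 2 ≤ A * (M * ‖u‖ ^ 2) :=
    h1.trans (mul_le_mul hA h3 h4 hA0)
  rw [Real.norm_eq_abs]
  refine abs_le_of_sq_le_sq ?_ (by positivity)
  rw [mul_pow, Real.sq_sqrt (mul_nonneg hA0 hM0)]
  linarith

/-- A set of covectors whose lengths are bounded and whose base points converge is eventually
contained in a compact set. -/
theorem exists_compact_of_tendsto {x : ℕ → CotangentBundle n Q} {q : Q}
    (hx : Tendsto (fun m => (x m).1) atTop (𝓝 q)) {A : ℝ} (hA0 : 0 ≤ A)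
    (hA : ∀ m, cometric g (x m).1 (x m).2 (x m).2 ≤ A) :
    ∃ K : Set (CotangentBundle n Q), IsCompact K ∧ ∀ᶠ m in atTop, x m ∈ K := by
  have hφ := IsManifold.chart_mem_maximalAtlas (I := 𝓡 n) (n := ∞) q
  have hq := mem_chart_source (Model n) q
  set φ := chartAt (Model n) q
  obtain ⟨r, hr, hball⟩ := Metric.nhds_basis_closedBall.mem_iff.1
    (φ.open_target.mem_nhds (φ.map_source hq))
  obtain ⟨M, hM⟩ := (isCompact_closedBall (φ q) r).exists_bound_of_continuousOn
    ((contDiffOn_localMetric (g := g) hφ).continuousOn.mono hball)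
  refine ⟨(bundleChart φ hφ).symm '' (Metric.closedBall (φ q) r ×ˢ
    Metric.closedBall (0 : DualModel n) (√(A * M))), ?_, ?_⟩
  · refine ((isCompact_closedBall _ _).prod (isCompact_closedBall _ _)).image_of_continuousOn
      ((bundleChart φ hφ).continuousOn_symm.mono ?_)
    exact prod_mono hball (subset_univ _)
  · filter_upwards [hx (φ.open_source.mem_nhds hq),
      hx ((φ.continuousAt hq).preimage_mem_nhds (Metric.closedBall_mem_nhds _ hr))] with m h1 h2
    refine ⟨bundleCoord φ (x m), ⟨h2, ?_⟩, (bundleChart φ hφ).left_inv h1⟩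
    exact mem_closedBall_zero_iff.2 (norm_bundleCoord_snd_le h1 (hA m) (hM _ h2) hA0)

theorem IsPhysicalOrbit.exists_tendsto_proj (hU : ContMDiff (𝓡 n) 𝓘(ℝ, ℝ) ∞ U)
    (hg : IsCompleteMetric g) {γ : ℝ → CotangentBundle n Q} {J : Set ℝ} (hJ : J.OrdConnected)
    (hγ : IsPhysicalOrbit g W (hamiltonian g U) J γ) {C : ℝ} (hC : 0 ≤ C)
    (hp : ∀ t ∈ J, cometric g (γ t).1 (γ t).2 (γ t).2 ≤ C ^ 2) {t : ℕ → ℝ} (ht : CauchySeq t)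
    (htJ : ∀ m, t m ∈ J) : ∃ q : Q, Tendsto (fun m => (γ (t m)).1) atTop (𝓝 q) := by
  let : RiemannianBundle (fun q : Q => TangentSpace (𝓡 n) q) := ⟨g.toRiemannianMetric⟩
  have hdist : ∀ i j, Manifold.riemannianEDist (𝓡 n) (γ (t i)).1 (γ (t j)).1 ≤
      ENNReal.ofReal (C * dist (t i) (t j)) := by
    intro i j
    rcases le_total (t i) (t j) with h | h
    · rw [dist_comm, Real.dist_eq, abs_of_nonneg (sub_nonneg.2 h)]
      exact hγ.riemannianEDist_le hU hC hp h (hJ.out (htJ i) (htJ j))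
    · rw [Real.dist_eq, abs_of_nonneg (sub_nonneg.2 h), Manifold.riemannianEDist_comm]
      exact hγ.riemannianEDist_le hU hC hp h (hJ.out (htJ j) (htJ i))
  refine hg _ fun ε hε => ?_
  obtain ⟨r, hr, hrε⟩ := ENNReal.lt_iff_exists_nnreal_btwn.1 hε
  have hr0 : (0 : ℝ) < r := by exact_mod_cast hr
  -- Dividing by `C + 1` rather than `C` allows `C = 0`.
  obtain ⟨N, hN⟩ := Metric.cauchySeq_iff.1 ht (r / (C + 1)) (by positivity)
  refine ⟨N, fun i hi j hj => ((hdist i j).trans ?_).trans_lt hrε⟩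
  rw [← ENNReal.ofReal_coe_nnreal]
  refine ENNReal.ofReal_le_ofReal ?_
  calc C * dist (t i) (t j) ≤ (C + 1) * (r / (C + 1)) := by
        gcongr
        · linarith
        · exact (hN i hi j hj).le
    _ = r := by field_simp

theorem IsPhysicalOrbit.eq_top_of_isCompleteMetric [T2Space Q]
    (hU : ContMDiff (𝓡 n) 𝓘(ℝ, ℝ) ∞ U) (hg : IsCompleteMetric g) (hb : BddBelow (range U))
    {T : EReal} {γ : ℝ → CotangentBundle n Q} (hT : 0 < T)
    (hγ : IsPhysicalOrbit g W (hamiltonian g U) (timeInterval T) γ)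
    (hmax : ∀ (T' : EReal) (γ' : ℝ → CotangentBundle n Q), 0 < T' →
        IsPhysicalOrbit g W (hamiltonian g U) (timeInterval T') γ' → γ' 0 = γ 0 → T' ≤ T) :
    T = ⊤ := by
  by_contra hne
  have hlt : T < ⊤ := lt_top_iff_ne_top.2 hne
  obtain ⟨b, hb⟩ := hb
  -- Along the orbit `g*(p, p) = 2 (H - U) ≤ 2 (H(γ 0) - b)`, by conservation of energy.
  set A := 2 * (hamiltonian g U (γ 0) - b)
  have hA : ∀ t ∈ timeInterval T, cometric g (γ t).1 (γ t).2 (γ t).2 ≤ A := by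
    intro t ht
    have h1 := hγ.hamiltonian_eq hU (ordConnected_timeInterval T) (uniqueDiffOn_timeInterval T)
      (zero_mem_timeInterval hT) ht
    have h2 : b ≤ U (γ t).1 := hb ⟨_, rfl⟩
    rw [hamiltonian] at h1
    simp only [A]
    linarith
  have hA0 : 0 ≤ A := by
    refine le_trans ?_ (hA 0 (zero_mem_timeInterval hT))
    rw [cometric]
    rcases eq_or_ne (sharp g (γ 0).1 (γ 0).2) 0 with h | h
    · rw [h]
      simp
    · exact (g.pos _ _ h).le
  lift T to ℝ using ⟨hne, (EReal.bot_lt_zero.trans hT).ne'⟩ with τ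
  have hτ : 0 < τ := EReal.coe_pos.1 hT
  -- These times start at `0` for `m = 0` and converge to `τ` without reaching it.
  have htT : ∀ m : ℕ, τ - τ * (1 / ((m : ℝ) + 1)) ∈ timeInterval τ := by
    intro m
    have h1 : (0 : ℝ) < 1 / ((m : ℝ) + 1) := by positivity
    have h2 : 1 / ((m : ℝ) + 1) ≤ 1 := by
      rw [div_le_one (by positivity)]
      linarith [(Nat.cast_nonneg m : (0 : ℝ) ≤ m)]
    rw [timeInterval_coe]
    constructor <;> nlinarith
  have htlim : Tendsto (fun m : ℕ => τ - τ * (1 / ((m : ℝ) + 1))) atTop (𝓝 τ) := by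
    simpa using (tendsto_one_div_add_atTop_nhds_zero_nat (𝕜 := ℝ)).const_mul τ |>.const_sub τ
  obtain ⟨q, hq⟩ := hγ.exists_tendsto_proj hU hg (ordConnected_timeInterval _)
    (Real.sqrt_nonneg A) (fun s hs => (hA s hs).trans_eq (Real.sq_sqrt hA0).symm)
    htlim.cauchySeq htT
  obtain ⟨K, hK, hev⟩ := exists_compact_of_tendsto hq hA0 fun m => hA _ (htT m)
  obtain ⟨t₀, ht₀, hout⟩ := hγ.eventually_notMem hU hT hlt hmax hK
  have hlt₀ : t₀ < τ := EReal.coe_lt_coe_iff.1 ht₀.2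
  obtain ⟨m, hm, hm'⟩ := (hev.and (htlim.eventually (lt_mem_nhds hlt₀))).exists
  exact hout _ (htT m) hm'.le hm

end

end ConstrainedMechanics

/-! ### Assembly of the four statements -/

theorem mainTheorem10 {n k : ℕ} {Q : Type*} [TopologicalSpace Q] [T2Space Q]
    [SecondCountableTopology Q] [ChartedSpace (Model n) Q] [IsManifold (𝓡 n) ∞ Q]
    (g : SmoothMetric n Q) (W : SmoothDistribution n k Q)
    (U : Q → ℝ) (hU : ContMDiff (𝓡 n) 𝓘(ℝ, ℝ) ∞ U) :
    -- the physical leaf is the zero set of `𝔭̄† p`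
    physicalLeaf g W (hamiltonian g U) =
      {x : CotangentBundle n Q | x.2.comp (coproj g W x.1) = 0} ∧
    -- the relations define a unique vector field tangent to the physical leaf, and it is smooth
    (∃ X : (x : CotangentBundle n Q) → TangentSpace (cotangentModel n) x,
      (∀ x ∈ physicalLeaf g W (hamiltonian g U), ∀ v : TangentSpace (cotangentModel n) x,
        ((⟨x, v⟩ : TangentBundle (cotangentModel n) (CotangentBundle n Q)) ∈
            tangentVectors (physicalLeaf g W (hamiltonian g U)) ∧
          SatisfiesRelations g W (hamiltonian g U) x v) ↔ v = X x) ∧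
      IsSmoothFieldAlong (physicalLeaf g W (hamiltonian g U)) X) ∧
    -- through every point there is a unique maximal physical orbit; if its life time is finite,
    -- then it leaves every compact set
    (∀ x ∈ physicalLeaf g W (hamiltonian g U), ∃ (T : EReal) (γ : ℝ → CotangentBundle n Q),
      0 < T ∧ IsPhysicalOrbit g W (hamiltonian g U) (timeInterval T) γ ∧ γ 0 = x ∧
      (∀ (T' : EReal) (γ' : ℝ → CotangentBundle n Q), 0 < T' →
        IsPhysicalOrbit g W (hamiltonian g U) (timeInterval T') γ' → γ' 0 = x →
        T' ≤ T ∧ EqOn γ' γ (timeInterval T')) ∧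
      (T < ⊤ → ∀ K : Set (CotangentBundle n Q), IsCompact K →
        ∃ t₀ ∈ timeInterval T, ∀ t ∈ timeInterval T, t₀ ≤ t → γ t ∉ K)) ∧
    -- if `(Q, g)` is complete and `U` is bounded below, the orbits are defined on `[0, ∞)`
    (IsCompleteMetric g → BddBelow (range U) →
      ∀ x ∈ physicalLeaf g W (hamiltonian g U), ∃ γ : ℝ → CotangentBundle n Q,
        IsPhysicalOrbit g W (hamiltonian g U) (Ici 0) γ ∧ γ 0 = x ∧
        ∀ γ' : ℝ → CotangentBundle n Q,
          IsPhysicalOrbit g W (hamiltonian g U) (Ici 0) γ' → γ' 0 = x → EqOn γ' γ (Ici 0)) := by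
  refine ⟨Set.ext fun x => mem_physicalLeaf_iff, exists_unique_field hU, fun x hx => ?_,
    fun hg hb x hx => ?_⟩
  all_goals obtain ⟨T, γ, hT, hγ, rfl, hmax⟩ := exists_maximal_orbit hU hx
  · exact ⟨T, γ, hT, hγ, rfl, hmax, fun hlt K hK => hγ.eventually_notMem hU hT hlt
      (fun T' γ' hT' hγ' h0 => (hmax T' γ' hT' hγ' h0).1) hK⟩
  · obtain rfl := hγ.eq_top_of_isCompleteMetric hU hg hb hT
      fun T' γ' hT' hγ' h0 => (hmax T' γ' hT' hγ' h0).1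
    rw [timeInterval_top] at hγ
    refine ⟨γ, hγ, rfl, fun γ' hγ' h0 => ?_⟩
    rw [← timeInterval_top] at hγ' ⊢
    exact (hmax ⊤ γ' hT hγ' h0).2
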